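/- Let $P$ be a convex $d$-polytope ($d\ge 0$), i.e. the nonempty convex hull of a finite set of points, of affine dimension $d$. The faces of $P$ include $\emptyset$ (of dimension $-1$) and $P$ itself. For $S=\{s_1<\dots<s_k\}\subseteq\{0,\dots,d-1\}$ let $f_S(P)$ be the number of chains $F_1\subset\cdots\subset F_k$ of faces of $P$ with $\dim F_i=s_i$, let $h_S(P)=\sum_{T\subseteq S}(-1)^{|S|-|T|}f_T(P)$, and let $w_S=w_0\cdots w_{d-1}$ be the word in the noncommuting indeterminates $\mathbf a,\mathbf b$ with $w_i=\mathbf b$ if $i\in S$ and $w_i=\mathbf a$ if $i\notin S$. The $\mathbf{ab}$-index of $P$ is $\Psi(P)=\sum_{S\subseteq\{0,\dots,d-1\}}h_S(P)\,w_S$. The $\mathbf{cd}$-index $\Phi(P)$ is the polynomial with integer coefficients in noncommuting indeterminates $\mathbf c,\mathbf d$ that becomes $\Psi(P)$ under the substitution $\mathbf c=\mathbf a+\mathbf b$, $\mathbf d=\mathbf{ab}+\mathbf{ba}$. The toric $h$-vector $h(\partial P)=(h_0,\dots,h_d)$ is defined recursively, with $h(\partial P,x)=\sum_{i=0}^d h_ix^{d-i}$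 and $g(\partial P,x)=\sum_{i=0}^{\lfloor d/2\rfloor}g_ix^i$, where $g_0=h_0$ and $g_i=h_i-h_{i-1}$ for $1\le i\le\lfloor d/2\rfloor$, by \[ h(\partial P,x)=\sum_{G}g(\partial G,x)(x-1)^{d-1-\dim G}, \] the sum being over all proper faces $G$ of $P$, including $G=\emptyset$, for which the factor $g(\partial G,x)$ is taken to be $1$. Let $\mathbf c$ and $\mathbf d$ also denote the linear operators, written on the right, that map a vector $(h_0,\dots,h_n)$ to vectors of length $n+2$ and $n+3$, respectively: with $m=\lfloor n/2\rfloor$ and $g_0,\dots,g_m$ formed from $h_0,\dots,h_n$ as above, \[ (h_0,\dots,h_n)\mathbf c=\begin{cases}(g_0,\dots,g_m,g_m,\dots,g_0)&n\text{ even},\\(g_0,\dots,g_m,0,g_m,\dots,g_0)&n\text{ odd},\end{cases} \qquad (h_0,\dots,h_n)\mathbf d=\begin{cases}(0,\dots,0,g_m,0,\dots,0)&n\text{ even},\\(0,\dots,0)&n\text{ odd},\end{cases} \] where $g_m$ is the middle entry in the second formula. A $\mathbf{cd}$-word acts on a vector letter by letter, the leftmost letter first, and a $\mathbf{cd}$-polynomial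 acts by linear extension. Then the $\mathbf{cd}$-index $\Phi(P)$ exists and is unique, and \[ h(\partial P)=(1)\,\Phi(P). \] -/

import Mathlib

open Polynomial

noncomputable section

namespace CDToric

section Polytopes

variable {E : Type*} [NormedAddCommGroup E] [NormedSpace ℝ E]

/-- The dimension of a subset of a real vector space: the dimension of its affine span, and `-1` for
the empty set. -/
def dim (A : Set E) : ℤ :=
  open Classical in if A = ∅ then -1 else (Module.finrank ℝ (vectorSpan ℝ A) : ℤ)

/-- A convex `d`-polytope: the convex hull of a finite set of points, of dimension `d` (in
particular nonempty, as `d` is a natural number). -/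
def IsPolytope (d : ℕ) (P : Set E) : Prop :=
  (∃ S : Finset E, P = convexHull ℝ (S : Set E)) ∧ dim P = d

/-- The faces of `∂P`, i.e. the proper faces of `P`. The empty set is one of them
if `P` is nonempty. -/
def properFaces (P : Set E) : Set (Set E) :=
  {G | IsExposed ℝ P G ∧ G ≠ P}

theorem dim_lt_of_mem_properFaces [FiniteDimensional ℝ E] {P G : Set E}
    (hG : G ∈ properFaces P) : dim G < dim P := by
  obtain ⟨hexp, hne⟩ := hG
  have hsub : G ⊆ P := hexp.subset
  have hP : P ≠ ∅ := by
    rintro rfl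
    exact hne (Set.subset_empty_iff.mp hsub)
  by_cases hG0 : G = ∅
  · simp only [dim, hG0, hP, if_true, if_false]
    have : (0 : ℤ) ≤ (Module.finrank ℝ (vectorSpan ℝ P) : ℤ) := Int.natCast_nonneg _
    linarith
  · simp only [dim, hG0, hP, if_false, Nat.cast_lt]
    obtain ⟨x, hx⟩ := Set.nonempty_iff_ne_empty.mpr hG0
    obtain ⟨l, hl⟩ := hexp ⟨x, hx⟩
    obtain ⟨y, hyP, hyG⟩ : ∃ y ∈ P, y ∉ G := by
      by_contra! h
      exact hne (Set.Subset.antisymm hsub h)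
    apply Submodule.finrank_lt_finrank_of_lt
    refine lt_of_le_of_ne (vectorSpan_mono ℝ hsub) fun heq => hyG ?_
    have hker : vectorSpan ℝ G ≤ LinearMap.ker (l : E →ₗ[ℝ] ℝ) := by
      rw [vectorSpan_def, Submodule.span_le]
      rintro _ ⟨u, hu, v, hv, rfl⟩
      rw [hl] at hu hv
      have h1 := hu.2 v hv.1
      have h2 := hv.2 u hu.1
      simp only [vsub_eq_sub, SetLike.mem_coe, LinearMap.mem_ker, map_sub,
        ContinuousLinearMap.coe_coe]
      linarith
    have hmem : y - x ∈ vectorSpan ℝ G := by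
      rw [heq]
      exact vsub_mem_vectorSpan ℝ hyP (hsub hx)
    have h0 : l y - l x = 0 := by simpa using hker hmem
    rw [hl] at hx ⊢
    exact ⟨hyP, fun z hz => by have := hx.2 z hz; linarith⟩

/-! ### The cd-index -/

/-- The flag number `f_S(P)`: the number of chains of faces `F_{s₁} ⊂ ⋯ ⊂ F_{s_k}` of `P` with
`dim F_s = s` for all `s ∈ S = {s₁ < ⋯ < s_k}`. -/
def flagF (P : Set E) (S : Finset ℕ) : ℕ :=
  Nat.card {F : S → Set E // StrictMono F ∧ ∀ s, IsExposed ℝ P (F s) ∧ dim (F s) = (s : ℕ)}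

/-- The flag `h`-vector. -/
def flagH (P : Set E) (S : Finset ℕ) : ℤ :=
  ∑ T ∈ S.powerset, (-1) ^ (S.card - T.card) * (flagF P T : ℤ)

/-- The letters `a`, `b`. -/
inductive AB : Type
  | a
  | b

/-- The letters `c`, `d`. -/
inductive CD : Type
  | c
  | d

/-- The word `w_0 ⋯ w_{n-1}` with `w_i = b` if `i ∈ S` and `w_i = a` otherwise. -/
def abWord (n : ℕ) (S : Finset ℕ) : FreeAlgebra ℤ AB :=
  ((List.range n).map fun i =>
    if i ∈ S then FreeAlgebra.ι ℤ AB.b else FreeAlgebra.ι ℤ AB.a).prod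

/-- The ab-index of a `d`-polytope. -/
def abIndex (d : ℕ) (P : Set E) : FreeAlgebra ℤ AB :=
  ∑ S ∈ (Finset.range d).powerset, flagH P S • abWord d S

/-- The substitution `c = a + b`, `d = ab + ba`. -/
def cdToAb : FreeAlgebra ℤ CD →ₐ[ℤ] FreeAlgebra ℤ AB :=
  FreeAlgebra.lift ℤ fun
    | CD.c => FreeAlgebra.ι ℤ AB.a + FreeAlgebra.ι ℤ AB.b
    | CD.d => FreeAlgebra.ι ℤ AB.a * FreeAlgebra.ι ℤ AB.b +
        FreeAlgebra.ι ℤ AB.b * FreeAlgebra.ι ℤ AB.a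

/-- `Φ` is the cd-index of the `d`-polytope `P`. -/
def IsCDIndex (d : ℕ) (P : Set E) (Φ : FreeAlgebra ℤ CD) : Prop :=
  cdToAb Φ = abIndex d P

/-! ### The toric h-vector -/

/-- The entries `g_0 = h_0`, `g_i = h_i - h_{i-1}` of the `g`-vector of `h_0, h_1, …`. -/
def gEntry {R : Type*} [Sub R] (h : ℕ → R) : ℕ → R
  | 0 => h 0
  | i + 1 => h (i + 1) - h i

/-- The polynomial `g(x) = ∑_{i ≤ ⌊d/2⌋} g_i x^i` obtained from `h(x) = ∑_{i ≤ d} h_i x^{d-i}`. -/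
def gPoly (d : ℕ) (h : ℤ[X]) : ℤ[X] :=
  ∑ i ∈ Finset.range (d / 2 + 1), C (gEntry (fun j => h.coeff (d - j)) i) * X ^ i

/-- The toric `h`-polynomial `h(∂P, x)`, defined by `h(∅, x) = g(∅, x) = 1` and
`h(∂P, x) = ∑_G g(∂G, x) (x - 1)^{dim P - 1 - dim G}`, where `G` runs over the faces of `∂P`,
the empty face included. -/
def toricHPoly [FiniteDimensional ℝ E] (P : Set E) : ℤ[X] :=
  open Classical in
  if P = ∅ then 1
  else ∑ᶠ G : properFaces P,
    (if (G : Set E) = ∅ then 1 else gPoly (dim (G : Set E)).toNat (toricHPoly (G : Set E))) *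
      (X - 1) ^ (dim P - 1 - dim (G : Set E)).toNat
termination_by (dim P + 1).toNat
decreasing_by
  have h := dim_lt_of_mem_properFaces G.2
  have h' : -1 ≤ dim (G : Set E) := by
    unfold dim
    split_ifs <;> omega
  omega

/-- The toric `h`-vector `(h_0, …, h_d)` of the boundary of a `d`-polytope, where
`h(∂P, x) = ∑ h_i x^{d-i}`. -/
def toricH [FiniteDimensional ℝ E] (d : ℕ) (P : Set E) : Fin (d + 1) → ℤ :=
  fun i => (toricHPoly P).coeff (d - i)

end Polytopes

/-! ### The operators `c` and `d` -/

/-- The entries of a vector `(h_0, …, h_d)`, continued by zero. -/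
def entry {d : ℕ} (h : Fin (d + 1) → ℤ) (i : ℕ) : ℤ :=
  if hi : i < d + 1 then h ⟨i, hi⟩ else 0

theorem gEntry_add {d : ℕ} (h k : Fin (d + 1) → ℤ) (i : ℕ) :
    gEntry (entry (h + k)) i = gEntry (entry h) i + gEntry (entry k) i := by
  have key : ∀ j, entry (h + k) j = entry h j + entry k j := fun j => by
    unfold entry; split_ifs <;> simp
  cases i with
  | zero => simp [gEntry, key]
  | succ i => simp only [gEntry, key]; ring

theorem gEntry_smul {d : ℕ} (r : ℤ) (h : Fin (d + 1) → ℤ) (i : ℕ) :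
    gEntry (entry (r • h)) i = r * gEntry (entry h) i := by
  have key : ∀ j, entry (r • h) j = r * entry h j := fun j => by
    unfold entry; split_ifs <;> simp
  cases i with
  | zero => simp only [gEntry, key]
  | succ i => simp only [gEntry, key]; ring

/-- `(h_0, …, h_d) c = (g_0, g_1, …, g_m, g_m, …, g_1, g_0)` if `d` is even and
`(g_0, g_1, …, g_m, 0, g_m, …, g_1, g_0)` if `d` is odd, where `m = ⌊d/2⌋`. -/
def cOp (d : ℕ) : (Fin (d + 1) → ℤ) →ₗ[ℤ] (Fin (d + 1 + 1) → ℤ) where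
  toFun h j :=
    if min (j : ℕ) (d + 1 - j) ≤ d / 2 then gEntry (entry h) (min (j : ℕ) (d + 1 - j)) else 0
  map_add' h k := by
    funext j
    simp only [gEntry_add, Pi.add_apply]
    split_ifs <;> simp
  map_smul' r h := by
    funext j
    simp only [gEntry_smul, Pi.smul_apply]
    split_ifs <;> simp

/-- `(h_0, …, h_d) d = (0, …, 0, g_{d/2}, 0, …, 0)`, with the nonzero entry in the middle, if `d` is
even, and `(0, …, 0)` if `d` is odd. -/
def dOp (d : ℕ) : (Fin (d + 1) → ℤ) →ₗ[ℤ] (Fin (d + 2 + 1) → ℤ) where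
  toFun h j := if Even d ∧ (j : ℕ) = d / 2 + 1 then gEntry (entry h) (d / 2) else 0
  map_add' h k := by
    funext j
    simp only [gEntry_add, Pi.add_apply]
    split_ifs <;> simp
  map_smul' r h := by
    funext j
    simp only [gEntry_smul, Pi.smul_apply]
    split_ifs <;> simp

/-- Formal sums of vectors `(h_0, …, h_d)` of various lengths `d + 1`. -/
abbrev Vectors : Type := DirectSum ℕ fun d => Fin (d + 1) → ℤ

/-- The vector `(h_0, …, h_d)` as an element of `Vectors`. -/
abbrev vec (d : ℕ) (h : Fin (d + 1) → ℤ) : Vectors :=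
  DirectSum.lof ℤ ℕ (fun d => Fin (d + 1) → ℤ) d h

/-- The letters `c` and `d` as operators. -/
def letterOp : CD → Module.End ℤ Vectors
  | CD.c => DirectSum.toModule ℤ ℕ Vectors fun d =>
      DirectSum.lof ℤ ℕ (fun d => Fin (d + 1) → ℤ) (d + 1) ∘ₗ cOp d
  | CD.d => DirectSum.toModule ℤ ℕ Vectors fun d =>
      DirectSum.lof ℤ ℕ (fun d => Fin (d + 1) → ℤ) (d + 2) ∘ₗ dOp d

/-- The right action of cd-polynomials: in `v Φ`, each word of `Φ` acts on `v`
letter by letter, its leftmost letter first (whence the opposite algebra). -/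
def act (v : Vectors) (Φ : FreeAlgebra ℤ CD) : Vectors :=
  (FreeAlgebra.lift ℤ (fun l => MulOpposite.op (letterOp l)) Φ).unop v

end CDToric

end

/-! Splitting a chain of faces at its largest member G gives, over the nonempty proper faces G of P,
Ψ(P) = (a-b)^d + ∑ Ψ(G) b (a-b)^(d-1-dim G), while the definition of the toric h-polynomial, with
the empty face split off, reads h(∂P) = (x-1)^d + ∑ g(∂G) (x-1)^(d-1-dim G). The two recursions
match. Let ab-words act from the right on polynomials tagged with a formal degree n, both a-b and b
raising n by one: a-b multiplies by x-1, and b replaces h by g. Then Ψ(P) sends 1 to h(∂P)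
(`toricOfAb_abIndex`). In this action c is (a-b)+2b and d is (a-b)b+b(a-b)+2bb. On palindromic
vectors these are exactly the operators c and d of the theorem (`toPoly_cOp`, `toPoly_dOp`). Their
values are again palindromic and (1) is palindromic, so the two actions of a cd-polynomial on (1)
agree (`vectorsToPoly_act`).

Existence of Φ is an induction over faces. Euler's relations for the intervals of the face lattice
turn the recursion for Ψ into a dual one. The sum of the two expresses 2Ψ(P) by the Ψ(G), by c, and
by even powers of a-b, where (a-b)² = c²-2d (`two_mul_eq_of_eulerian`). Reading off last letters
shows that the cd-polynomials form a saturated subgroup of the ab-polynomials. This permits the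
division by 2 and also gives uniqueness (`exists_eq_smul_of_cdToAb_eq_smul`).

Euler's relations rest on an additive Euler characteristic of convex sets, computed by slicing with
hyperplanes (`sum_eq_zero_of_hasEulerChar`). It is applied to the partition of P into relative
interiors of faces and, for upper intervals, to a cap of P cut off transversally to a face. -/

noncomputable section

namespace CDToric

/-! ### Injectivity of the substitution `c = a + b`, `d = ab + ba` -/

section FreeAlgebra

variable {X : Type*}

/-- The algebra homomorphism to upper triangular matrices whose upper right entry is the right Fox
derivative with respect to the letter `x`. -/
def foxMatrix (x : X) : FreeAlgebra ℤ X →ₐ[ℤ] Matrix (Fin 2) (Fin 2) (FreeAlgebra ℤ X) :=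
  open Classical in
  FreeAlgebra.lift ℤ fun y => !![FreeAlgebra.ι ℤ y, if y = x then 1 else 0; 0, 0]

/-- The right Fox derivative: the linear map that sends `w x` to `w`, and all words that do not
end with `x` to zero. -/
def foxDeriv (x : X) : FreeAlgebra ℤ X →ₗ[ℤ] FreeAlgebra ℤ X where
  toFun w := foxMatrix x w 0 1
  map_add' v w := by simp
  map_smul' r w := by
    rw [map_zsmul]
    rfl

/-- With this first column, multiplicativity of `foxMatrix` becomes the product rule D(vw) = v D(w)
+ D(v) ε(w), where the lower right entry ε(w) is the constant term of w. It vanishes on letters, so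
D picks out the last letter. -/
theorem foxMatrix_left (x : X) (w : FreeAlgebra ℤ X) :
    foxMatrix x w 0 0 = w ∧ foxMatrix x w 1 0 = 0 := by
  induction w with
  | grade0 r =>
    simp only [AlgHom.commutes, Matrix.algebraMap_matrix_apply]
    simp
  | grade1 y => simp [foxMatrix]
  | mul v w hv hw => simp [Matrix.mul_apply, hv, hw]
  | add v w hv hw => simp [hv, hw]

theorem foxDeriv_algebraMap (x : X) (r : ℤ) : foxDeriv x (algebraMap ℤ _ r) = 0 := by
  simp only [foxDeriv, LinearMap.coe_mk, AddHom.coe_mk, AlgHom.commutes,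
    Matrix.algebraMap_matrix_apply]
  simp

theorem foxDeriv_mul_ι_self (x : X) (w : FreeAlgebra ℤ X) :
    foxDeriv x (w * FreeAlgebra.ι ℤ x) = w := by
  simp [foxDeriv, Matrix.mul_apply, foxMatrix_left x w]
  simp [foxMatrix]

theorem foxDeriv_mul_ι_of_ne {x y : X} (h : y ≠ x) (w : FreeAlgebra ℤ X) :
    foxDeriv x (w * FreeAlgebra.ι ℤ y) = 0 := by
  simp [foxDeriv, Matrix.mul_apply, foxMatrix_left x w]
  simp [foxMatrix, h]

end FreeAlgebra

/-- The letter `a` of the free algebra. -/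
abbrev la : FreeAlgebra ℤ AB := FreeAlgebra.ι ℤ AB.a

/-- The letter `b` of the free algebra. -/
abbrev lb : FreeAlgebra ℤ AB := FreeAlgebra.ι ℤ AB.b

/-- The letter `c` of the free algebra. -/
abbrev lc : FreeAlgebra ℤ CD := FreeAlgebra.ι ℤ CD.c

/-- The letter `d` of the free algebra. -/
abbrev ld : FreeAlgebra ℤ CD := FreeAlgebra.ι ℤ CD.d

@[simp] theorem cdToAb_lc : cdToAb lc = la + lb := by simp [cdToAb]

@[simp] theorem cdToAb_ld : cdToAb ld = la * lb + lb * la := by simp [cdToAb]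

/-! ### Induction on the last letter, and saturation of the cd-polynomials -/

/-- Generation of cd-polynomials by appending letters on the right. -/
inductive RightGenerated : FreeAlgebra ℤ CD → Prop
  | const (r : ℤ) : RightGenerated (algebraMap ℤ _ r)
  | append (r : ℤ) {Φ₁ Φ₂ : FreeAlgebra ℤ CD} : RightGenerated Φ₁ → RightGenerated Φ₂ →
      RightGenerated (algebraMap ℤ _ r + Φ₁ * lc + Φ₂ * ld)

namespace RightGenerated

theorem zero : RightGenerated 0 := by simpa using const 0

theorem const_add (s : ℤ) {Φ : FreeAlgebra ℤ CD} (h : RightGenerated Φ) :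
    RightGenerated (algebraMap ℤ _ s + Φ) := by
  cases h with
  | const r => rw [← map_add]; exact const _
  | append r h₁ h₂ =>
    rw [← add_assoc, ← add_assoc, ← map_add]; exact append _ h₁ h₂

theorem add {Φ Θ : FreeAlgebra ℤ CD} (hΦ : RightGenerated Φ) (hΘ : RightGenerated Θ) :
    RightGenerated (Φ + Θ) := by
  induction hΦ generalizing Θ with
  | const r => exact hΘ.const_add r
  | append r h₁ h₂ ih₁ ih₂ =>
    cases hΘ with
    | const s =>
      rw [add_comm]; exact (append r h₁ h₂).const_add s
    | append s k₁ k₂ =>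
      have := append (r + s) (ih₁ k₁) (ih₂ k₂)
      convert this using 1
      rw [map_add, add_mul, add_mul]; abel

theorem smul (s : ℤ) {Φ : FreeAlgebra ℤ CD} (hΦ : RightGenerated Φ) :
    RightGenerated (s • Φ) := by
  induction hΦ with
  | const r => rw [← map_zsmul]; exact const _
  | append r h₁ h₂ ih₁ ih₂ =>
    rw [smul_add, smul_add, ← smul_mul_assoc, ← smul_mul_assoc, ← map_zsmul]
    exact append _ ih₁ ih₂

theorem mul {Φ Θ : FreeAlgebra ℤ CD} (hΦ : RightGenerated Φ) (hΘ : RightGenerated Θ) :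
    RightGenerated (Φ * Θ) := by
  induction hΘ with
  | const r => rw [← Algebra.commutes, ← Algebra.smul_def]; exact hΦ.smul r
  | append r h₁ h₂ ih₁ ih₂ =>
    rw [mul_add, mul_add, ← mul_assoc, ← mul_assoc, ← Algebra.commutes, ← Algebra.smul_def, add_assoc]
    have := append 0 ih₁ ih₂
    rw [map_zero, zero_add] at this
    exact (hΦ.smul r).add this

/-- Gives induction by removing the last letter, which suits both the right Fox derivative and a
right action, where an appended letter acts last. -/
theorem all (Φ : FreeAlgebra ℤ CD) : RightGenerated Φ := by
  have one : RightGenerated 1 := by simpa using const 1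
  induction Φ with
  | grade0 r => exact const r
  | grade1 l => cases l with
    | c => simpa using append 0 one zero
    | d => simpa using append 0 zero one
  | mul _ _ h k => exact h.mul k
  | add _ _ h k => exact h.add k

end RightGenerated

/-- The image of the cd-polynomials is a saturated subgroup of the ab-polynomials. -/
theorem exists_eq_smul_of_cdToAb_eq_smul (n : ℤ) (Φ : FreeAlgebra ℤ CD) (y : FreeAlgebra ℤ AB)
    (h : cdToAb Φ = n • y) : ∃ Θ : FreeAlgebra ℤ CD, Φ = n • Θ := by
  have hab : AB.a ≠ AB.b := by simp
  induction RightGenerated.all Φ generalizing y with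
  | const r =>
    have := congrArg FreeAlgebra.algebraMapInv h
    rw [AlgHom.commutes, FreeAlgebra.algebraMap_leftInverse, map_zsmul] at this
    exact ⟨algebraMap ℤ _ (FreeAlgebra.algebraMapInv y), by rw [this, map_zsmul]⟩
  | @append r Φ₁ Φ₂ _ _ ih₁ ih₂ =>
    -- The image of r + Φ₁c + Φ₂d, sorted by last letter. The constant term and the two Fox
    -- derivatives can now be compared separately with those of `y`.
    have h' : algebraMap ℤ _ r + (cdToAb Φ₁ + cdToAb Φ₂ * lb) * la +
        (cdToAb Φ₁ + cdToAb Φ₂ * la) * lb = n • y := by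
      rw [← h]; simp; noncomm_ring
    have h0 : r = n • FreeAlgebra.algebraMapInv y := by
      have := congrArg FreeAlgebra.algebraMapInv h'
      simp only [map_add, map_mul, map_zsmul] at this
      simpa [FreeAlgebra.algebraMapInv] using this
    have ha : cdToAb Φ₁ + cdToAb Φ₂ * lb = n • foxDeriv AB.a y := by
      have := congrArg (foxDeriv AB.a) h'
      simpa only [map_add, foxDeriv_algebraMap, foxDeriv_mul_ι_self,
        foxDeriv_mul_ι_of_ne hab.symm, map_zsmul, add_zero, zero_add] using this
    have hb : cdToAb Φ₁ + cdToAb Φ₂ * la = n • foxDeriv AB.b y := by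
      have := congrArg (foxDeriv AB.b) h'
      simpa only [map_add, foxDeriv_algebraMap, foxDeriv_mul_ι_self,
        foxDeriv_mul_ι_of_ne hab, map_zsmul, add_zero, zero_add] using this
    -- The difference of `hb` and `ha` eliminates Φ₁ and leaves Φ₂a - Φ₂b, from which another
    -- derivative by a extracts Φ₂.
    have h2 : cdToAb Φ₂ = n • foxDeriv AB.a (foxDeriv AB.b y - foxDeriv AB.a y) := by
      have : cdToAb Φ₂ * la - cdToAb Φ₂ * lb = n • (foxDeriv AB.b y - foxDeriv AB.a y) := by
        rw [smul_sub, ← ha, ← hb]; abel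
      have := congrArg (foxDeriv AB.a) this
      simpa only [map_sub, foxDeriv_mul_ι_self, foxDeriv_mul_ι_of_ne hab.symm, map_zsmul,
        sub_zero] using this
    obtain ⟨Θ₂, h₂⟩ := ih₂ _ h2
    obtain ⟨Θ₁, h₁⟩ := ih₁ (foxDeriv AB.a y - cdToAb Θ₂ * lb) (by
      rw [smul_sub, ← ha, h₂, map_zsmul, smul_mul_assoc]; abel)
    refine ⟨algebraMap ℤ _ (FreeAlgebra.algebraMapInv y) + Θ₁ * lc + Θ₂ * ld, ?_⟩
    rw [h0, h₁, h₂, map_zsmul, smul_add, smul_add, smul_mul_assoc, smul_mul_assoc]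

/-- Saturation with n = 0. -/
theorem cdToAb_injective : Function.Injective cdToAb := by
  rw [injective_iff_map_eq_zero]
  intro Φ h
  obtain ⟨Θ, rfl⟩ := exists_eq_smul_of_cdToAb_eq_smul 0 Φ 0 (by simpa using h)
  simp

/-- Saturation with n = 2, followed by cancelling 2 in the torsion-free free algebra. This is what
makes the coefficients of Φ integers. -/
theorem mem_range_cdToAb_of_two_mul {y : FreeAlgebra ℤ AB} (h : 2 * y ∈ cdToAb.range) :
    y ∈ cdToAb.range := by
  obtain ⟨Φ, hΦ⟩ := h
  have hΦ : cdToAb Φ = 2 * y := hΦ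
  obtain ⟨Θ, rfl⟩ := exists_eq_smul_of_cdToAb_eq_smul 2 Φ y (by
    rw [hΦ, two_mul, two_zsmul])
  refine ⟨Θ, ?_⟩
  have : (2 : ℤ) • (cdToAb Θ - y) = 0 := by
    rw [smul_sub, ← map_zsmul, hΦ, two_mul, two_zsmul, sub_self]
  have h0 : cdToAb Θ - y = 0 := (smul_eq_zero.mp this).resolve_left two_ne_zero
  exact sub_eq_zero.mp h0

/-! ### The ab-index of an Eulerian poset -/

/-- If the elements `ψ w` of a ring satisfy the recursion of the ab-index over an Eulerian poset
(with bottom element removed), then twice the element at the top has an expression that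
involves `b` only in `(e + b) + b` and `e` only in even powers. -/
theorem two_mul_eq_of_eulerian {ι R : Type*} [Ring R] [PartialOrder ι] [DecidableLT ι]
    [DecidableLE ι] (s : Finset ι) (n : ι → ℕ)
    (hn : ∀ x ∈ s, ∀ y ∈ s, x < y → n x < n y) {y : ι} (hy : y ∈ s) (htop : ∀ z ∈ s, z ≤ y)
    (ψ : ι → R) (e b : R)
    (hrec : ∀ w ∈ s, ψ w = e ^ n w + ∑ z ∈ s with z < w, ψ z * b * e ^ (n w - n z - 1))
    (heul₀ : ∑ w ∈ s, (-1 : ℤ) ^ n w = 1)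
    (heul : ∀ z ∈ s, z < y → ∑ w ∈ s with z ≤ w, (-1 : ℤ) ^ n w = 0) :
    2 * ψ y = (1 + (-1) ^ n y) * e ^ n y + ∑ z ∈ s with z < y,
      ψ z * (b - (-1) ^ (n y - n z) * (e + b)) * e ^ (n y - n z - 1) := by
  classical
  have hle : ∀ w ∈ s, n w ≤ n y := fun w hw => by
    rcases (htop w hw).eq_or_lt with rfl | h
    · exact le_rfl
    · exact (hn _ hw _ hy h).le
  have hsign : ∀ {k m : ℕ}, k ≤ m → (-1 : ℤ) ^ (m - k) = (-1) ^ m * (-1) ^ k := by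
    intro k m h
    obtain ⟨j, rfl⟩ := Nat.exists_eq_add_of_le h
    rw [Nat.add_sub_cancel_left, pow_add, mul_right_comm, ← mul_pow]
    simp
  have hzsign : ∀ k : ℕ, (-1 : R) ^ k = (((-1 : ℤ) ^ k : ℤ) : R) := by intro k; simp
  have hcomm : ∀ (k : ℕ) (x : R), (-1) ^ k * x = x * (-1) ^ k := fun k x =>
    ((Commute.neg_one_left x).pow_left k).eq
  have hsplit : ∑ w ∈ s, ψ w * (-e) ^ (n y - n w) =
      ψ y + ∑ z ∈ s with z < y, ψ z * (-e) ^ (n y - n z) := by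
    have : s = insert y (s.filter (· < y)) := by
      ext w
      simp only [Finset.mem_insert, Finset.mem_filter]
      constructor
      · intro hw
        rcases (htop w hw).eq_or_lt with h | h
        · exact Or.inl h
        · exact Or.inr ⟨hw, h⟩
      · rintro (rfl | h)
        · exact hy
        · exact h.1
    conv_lhs => rw [this]
    rw [Finset.sum_insert (by simp)]
    simp
  -- Inserting the recursion for each ψ w makes every exponent of e independent of w. After
  -- exchanging the sums only alternating sums of signs over w remain, and the Eulerian hypotheses
  -- evaluate them.
  have hdual : ∑ w ∈ s, ψ w * (-e) ^ (n y - n w) = (-1) ^ n y * e ^ n y -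
      ∑ z ∈ s with z < y, ψ z * b * ((-1) ^ (n y - n z) * e ^ (n y - n z - 1)) := by
    have h1 : ∑ w ∈ s, ψ w * (-e) ^ (n y - n w) = ∑ w ∈ s, e ^ n w * (-e) ^ (n y - n w) +
        ∑ w ∈ s, ∑ z ∈ s with z < w, ψ z * b * e ^ (n w - n z - 1) * (-e) ^ (n y - n w) := by
      rw [← Finset.sum_add_distrib]
      refine Finset.sum_congr rfl fun w hw => ?_
      conv_lhs => rw [hrec w hw]
      rw [add_mul, Finset.sum_mul]
    have h2 : ∑ w ∈ s, e ^ n w * (-e) ^ (n y - n w) = (-1) ^ n y * e ^ n y := by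
      have : ∀ w ∈ s, e ^ n w * (-e) ^ (n y - n w) =
          (((-1 : ℤ) ^ n y * (-1) ^ n w : ℤ) : R) * e ^ n y := by
        intro w hw
        rw [neg_pow, ← mul_assoc, ← hcomm, mul_assoc, ← pow_add, Nat.add_sub_cancel' (hle w hw),
          hzsign, hsign (hle w hw)]
      rw [Finset.sum_congr rfl this, ← Finset.sum_mul, ← Int.cast_sum, ← Finset.mul_sum, heul₀]
      simp
    have h3 : ∑ w ∈ s, ∑ z ∈ s with z < w,
          ψ z * b * e ^ (n w - n z - 1) * (-e) ^ (n y - n w) =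
        -∑ z ∈ s with z < y, ψ z * b * ((-1) ^ (n y - n z) * e ^ (n y - n z - 1)) := by
      have : ∀ w ∈ s, ∑ z ∈ s with z < w,
          ψ z * b * e ^ (n w - n z - 1) * (-e) ^ (n y - n w) =
          ∑ z ∈ s with z < y, if z < w then
            ψ z * b * e ^ (n y - n z - 1) * (((-1 : ℤ) ^ n y * (-1) ^ n w : ℤ) : R) else 0 := by
        intro w hw
        rw [← Finset.sum_filter, Finset.filter_filter]
        refine Finset.sum_congr ?_ fun z hz => ?_
        · ext z
          simp only [Finset.mem_filter]
          exact ⟨fun h => ⟨h.1, h.2.trans_le (htop w hw), h.2⟩, fun h => ⟨h.1, h.2.2⟩⟩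
        · simp only [Finset.mem_filter] at hz
          have hlt := hn _ hz.1 _ hw hz.2.2
          have hle' := hle w hw
          rw [neg_pow, hcomm, mul_assoc, ← mul_assoc (e ^ _), ← pow_add,
            show n w - n z - 1 + (n y - n w) = n y - n z - 1 by omega, ← hsign hle', ← hzsign]
          simp only [mul_assoc]
      rw [Finset.sum_congr rfl this, Finset.sum_comm, ← Finset.sum_neg_distrib]
      refine Finset.sum_congr rfl fun z hz => ?_
      simp only [Finset.mem_filter] at hz
      rw [← Finset.sum_filter, ← Finset.mul_sum, ← Int.cast_sum, ← Finset.mul_sum]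
      -- The alternating sum over [z, y] vanishes; its term w = z is moved to the other side.
      have h4 : ∑ w ∈ s with z < w, (-1 : ℤ) ^ n w = -(-1) ^ n z := by
        have := heul z hz.1 hz.2
        have hs : s.filter (z ≤ ·) = insert z (s.filter (z < ·)) := by
          ext w
          simp only [Finset.mem_insert, Finset.mem_filter]
          constructor
          · rintro ⟨hw, h⟩
            rcases h.eq_or_lt with h | h
            · exact Or.inl h.symm
            · exact Or.inr ⟨hw, h⟩
          · rintro (rfl | h)
            · exact ⟨hz.1, le_rfl⟩
            · exact ⟨h.1, h.2.le⟩
        rw [hs, Finset.sum_insert (by simp)] at this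
        linarith
      rw [h4, mul_neg, ← hsign (hle z hz.1), Int.cast_neg, ← hzsign, mul_neg, hcomm, mul_assoc]
    rw [h1, h2, h3, sub_eq_add_neg]
  have hψ : ψ y = (-1) ^ n y * e ^ n y - ∑ z ∈ s with z < y,
      (ψ z * b * ((-1) ^ (n y - n z) * e ^ (n y - n z - 1)) + ψ z * (-e) ^ (n y - n z)) := by
    rw [Finset.sum_add_distrib, ← sub_sub, ← hdual, hsplit]; abel
  -- One copy of ψ y is expanded by the recursion, the other by its dual `hψ`.
  rw [two_mul]
  nth_rewrite 1 [hrec y hy]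
  rw [hψ, add_mul, one_mul, sub_eq_add_neg, ← Finset.sum_neg_distrib, add_add_add_comm,
    ← Finset.sum_add_distrib]
  congr 1
  refine Finset.sum_congr rfl fun z hz => ?_
  simp only [Finset.mem_filter] at hz
  have hlt := hn _ hz.1 _ hy hz.2
  obtain ⟨k, hk⟩ : ∃ k, n y - n z = k + 1 := ⟨n y - n z - 1, by omega⟩
  rw [hk, Nat.add_sub_cancel, neg_pow e, pow_succ' e]
  simp only [mul_sub, sub_mul, mul_add, add_mul, mul_assoc, hcomm]
  abel

/-! ### The toric `h`-polynomial as a function of the ab-index -/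

theorem gEntry_congr {R : Type*} [Sub R] {h k : ℕ → R} {i : ℕ} (H : ∀ j ≤ i, h j = k j) :
    gEntry h i = gEntry k i := by
  cases i with
  | zero => exact H 0 le_rfl
  | succ i => simp only [gEntry]; rw [H _ le_rfl, H _ i.le_succ]

theorem coeff_gPoly (n : ℕ) (p : ℤ[X]) (k : ℕ) :
    (gPoly n p).coeff k = if k ≤ n / 2 then gEntry (fun j => p.coeff (n - j)) k else 0 := by
  simp only [gPoly, finsetSum_coeff, coeff_C_mul, coeff_X_pow]
  simp

/-- The map `h ↦ g` on polynomials, as a linear map. -/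
def gLin (n : ℕ) : ℤ[X] →ₗ[ℤ] ℤ[X] where
  toFun := gPoly n
  map_add' p q := by
    ext k
    simp only [coeff_gPoly, coeff_add]
    cases k <;> simp only [gEntry] <;> split_ifs <;> ring
  map_smul' r p := by
    ext k
    simp only [coeff_gPoly, coeff_smul, smul_eq_mul, RingHom.id_apply]
    cases k <;> simp only [gEntry] <;> split_ifs <;> ring

/-- The operator `(n, h) ↦ (n + 1, (x - 1) h)` through which `a - b` acts. -/
def eOp : Module.End ℤ (ℕ →₀ ℤ[X]) :=
  Finsupp.lsum ℤ fun n => Finsupp.lsingle (n + 1) ∘ₗ LinearMap.mulLeft ℤ (X - 1)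

/-- The operator `(n, h) ↦ (n + 1, g)` through which `b` acts. -/
def bOp : Module.End ℤ (ℕ →₀ ℤ[X]) :=
  Finsupp.lsum ℤ fun n => Finsupp.lsingle (n + 1) ∘ₗ gLin n

theorem eOp_single (n : ℕ) (p : ℤ[X]) :
    eOp (Finsupp.single n p) = Finsupp.single (n + 1) ((X - 1) * p) := by
  simp [eOp]

theorem bOp_single (n : ℕ) (p : ℤ[X]) :
    bOp (Finsupp.single n p) = Finsupp.single (n + 1) (gPoly n p) := by
  rw [bOp, Finsupp.lsum_single]
  rfl

/-- The right action of ab-polynomials on formal sums of `h`-polynomials of various degrees. -/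
def abAction : FreeAlgebra ℤ AB →ₐ[ℤ] (Module.End ℤ (ℕ →₀ ℤ[X]))ᵐᵒᵖ :=
  FreeAlgebra.lift ℤ fun
    | AB.a => MulOpposite.op (eOp + bOp)
    | AB.b => MulOpposite.op bOp

/-- The result of the action of an ab-polynomial on the polynomial `1` of degree `0`. -/
def toricOfAb (w : FreeAlgebra ℤ AB) : ℕ →₀ ℤ[X] :=
  (abAction w).unop (Finsupp.single 0 1)

theorem toricOfAb_add (v w : FreeAlgebra ℤ AB) :
    toricOfAb (v + w) = toricOfAb v + toricOfAb w := by
  simp [toricOfAb]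

theorem toricOfAb_sum {ι : Type*} (s : Finset ι) (f : ι → FreeAlgebra ℤ AB) :
    toricOfAb (∑ i ∈ s, f i) = ∑ i ∈ s, toricOfAb (f i) := by
  exact map_sum (AddMonoidHom.mk' toricOfAb toricOfAb_add) f s

theorem toricOfAb_algebraMap (r : ℤ) :
    toricOfAb (algebraMap ℤ _ r) = r • Finsupp.single 0 1 := by
  simp only [toricOfAb, AlgHom.commutes]
  rfl

theorem toricOfAb_mul_lb (w : FreeAlgebra ℤ AB) : toricOfAb (w * lb) = bOp (toricOfAb w) := by
  simp [toricOfAb, abAction]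

theorem toricOfAb_mul_la (w : FreeAlgebra ℤ AB) :
    toricOfAb (w * la) = eOp (toricOfAb w) + bOp (toricOfAb w) := by
  simp [toricOfAb, abAction]

theorem toricOfAb_mul_sub (w : FreeAlgebra ℤ AB) :
    toricOfAb (w * (la - lb)) = eOp (toricOfAb w) := by
  simp [toricOfAb, abAction]

theorem toricOfAb_mul_sub_pow (w : FreeAlgebra ℤ AB) {n : ℕ} {p : ℤ[X]}
    (h : toricOfAb w = Finsupp.single n p) (k : ℕ) :
    toricOfAb (w * (la - lb) ^ k) = Finsupp.single (n + k) (p * (X - 1) ^ k) := by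
  induction k with
  | zero => simpa using h
  | succ k ih =>
    rw [pow_succ, ← mul_assoc, toricOfAb_mul_sub, ih, eOp_single]
    congr 1
    ring

/-! ### Comparison with the operators `c` and `d` -/

/-- The polynomial `∑ h_i x^{n-i}`. -/
def toPoly (n : ℕ) : (Fin (n + 1) → ℤ) →ₗ[ℤ] ℤ[X] where
  toFun h := ∑ i : Fin (n + 1), C (h i) * X ^ (n - (i : ℕ))
  map_add' h k := by simp [add_mul, Finset.sum_add_distrib]
  map_smul' r h := by simp [Finset.mul_sum, mul_assoc]

/-- The vector of coefficients of a polynomial, in reversed order. -/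
def ofPoly (n : ℕ) : ℤ[X] →ₗ[ℤ] (Fin (n + 1) → ℤ) where
  toFun p i := p.coeff (n - (i : ℕ))
  map_add' p q := by ext; simp
  map_smul' r p := by ext; simp

theorem coeff_toPoly (n : ℕ) (h : Fin (n + 1) → ℤ) (k : ℕ) :
    (toPoly n h).coeff k = if k ≤ n then entry h (n - k) else 0 := by
  simp only [toPoly, LinearMap.coe_mk, AddHom.coe_mk, finsetSum_coeff, coeff_C_mul, coeff_X_pow]
  split_ifs with hk
  · rw [Finset.sum_eq_single ⟨n - k, by omega⟩]
    · simp [entry, Nat.sub_sub_self hk]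
    · intro i _ hi
      have : k ≠ n - (i : ℕ) := fun h' => hi (Fin.ext (by simp; omega))
      simp [this]
    · simp
  · refine Finset.sum_eq_zero fun i _ => ?_
    have : k ≠ n - (i : ℕ) := by omega
    simp [this]

theorem ofPoly_toPoly (n : ℕ) (h : Fin (n + 1) → ℤ) : ofPoly n (toPoly n h) = h := by
  ext i
  have h1 : (i : ℕ) ≤ n := Nat.lt_succ_iff.mp i.2
  simp only [ofPoly, LinearMap.coe_mk, AddHom.coe_mk, coeff_toPoly, Nat.sub_le, if_true,
    Nat.sub_sub_self h1, entry, i.2, dif_pos]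

/-- Palindromic vectors. -/
def palindromic (n : ℕ) : Submodule ℤ (Fin (n + 1) → ℤ) where
  carrier := {h | ∀ i, h i.rev = h i}
  add_mem' hh hk i := by simp [hh i, hk i]
  zero_mem' i := rfl
  smul_mem' r h hh i := by simp [hh i]

theorem entry_of_lt {n : ℕ} (h : Fin (n + 1) → ℤ) {k : ℕ} (hk : n < k) : entry h k = 0 := by
  rw [entry, dif_neg (by omega)]

theorem entry_sub_of_mem_palindromic {n : ℕ} {h : Fin (n + 1) → ℤ} (hh : h ∈ palindromic n)
    {k : ℕ} (hk : k ≤ n) : entry h (n - k) = entry h k := by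
  have := hh ⟨k, by omega⟩
  rw [entry, entry, dif_pos (by omega), dif_pos (by omega), ← this]
  congr 1
  ext
  simp [Fin.rev]

theorem coeff_toPoly_of_mem_palindromic {n : ℕ} {h : Fin (n + 1) → ℤ} (hh : h ∈ palindromic n)
    (k : ℕ) : (toPoly n h).coeff k = entry h k := by
  rw [coeff_toPoly]
  split_ifs with hk
  · exact entry_sub_of_mem_palindromic hh hk
  · exact (entry_of_lt h (by omega)).symm

theorem coeff_X_sub_one_mul (p : ℤ[X]) (k : ℕ) :
    ((X - 1) * p).coeff k = (match k with | 0 => 0 | k + 1 => p.coeff k) - p.coeff k := by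
  cases k <;> simp [sub_mul]

theorem coeff_gPoly_toPoly {n : ℕ} (h : Fin (n + 1) → ℤ) (k : ℕ) :
    (gPoly n (toPoly n h)).coeff k = if k ≤ n / 2 then gEntry (entry h) k else 0 := by
  rw [coeff_gPoly]
  split_ifs with hk
  · refine gEntry_congr fun j hj => ?_
    rw [coeff_toPoly, if_pos (Nat.sub_le _ _), Nat.sub_sub_self (by omega)]
  · rfl

/-- In xh - h the power x^(n+1-j) has coefficient h_j - h_(j-1). The ends j = 0 and j = n+1 fit
because `entry` continues by zero. -/
theorem coeff_X_sub_one_mul_toPoly {n : ℕ} {h : Fin (n + 1) → ℤ} (hh : h ∈ palindromic n) {j : ℕ}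
    (hj : j ≤ n + 1) : ((X - 1) * toPoly n h).coeff (n + 1 - j) = gEntry (entry h) j := by
  rw [coeff_X_sub_one_mul]
  simp only [coeff_toPoly_of_mem_palindromic hh]
  rcases j with _ | j
  · have := entry_sub_of_mem_palindromic hh (Nat.zero_le n)
    simp only [Nat.sub_zero] at this
    simp [gEntry, this, entry_of_lt]
  · rw [show n + 1 - (j + 1) = n - j by omega, entry_sub_of_mem_palindromic hh (by omega), gEntry]
    rcases eq_or_lt_of_le (show j ≤ n by omega) with rfl | h'
    · simp [entry_of_lt]
    · obtain ⟨i, hi⟩ : ∃ i, n - j = i + 1 := ⟨n - j - 1, by omega⟩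
      have := entry_sub_of_mem_palindromic hh (show j + 1 ≤ n by omega)
      rw [show n - (j + 1) = i by omega] at this
      rw [hi]
      simp [this]

/-- For palindromic h the coefficients of (x-1)h are antisymmetric: g_0, …, g_m, then -g_m, …, -g_0,
with a zero in the middle if n is odd. Adding 2g, which lives in the degrees up to m, flips the
signs of the second half. -/
theorem toPoly_cOp {n : ℕ} {h : Fin (n + 1) → ℤ} (hh : h ∈ palindromic n) :
    toPoly (n + 1) (cOp n h) = (X - 1) * toPoly n h + 2 * gPoly n (toPoly n h) := by
  ext k
  rw [coeff_add, show (2 : ℤ[X]) = C 2 by simp, coeff_C_mul, coeff_gPoly_toPoly, coeff_toPoly]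
  rcases lt_or_ge (n + 1) k with hk | hk
  · rw [if_neg (by omega), if_neg (by omega), coeff_X_sub_one_mul]
    obtain ⟨i, rfl⟩ : ∃ i, k = i + 1 := ⟨k - 1, by omega⟩
    simp only [coeff_toPoly_of_mem_palindromic hh]
    rw [entry_of_lt _ (by omega), entry_of_lt _ (by omega)]
    simp
  · have h1 := coeff_X_sub_one_mul_toPoly hh (show n + 1 - k ≤ n + 1 by omega)
    rw [Nat.sub_sub_self hk] at h1
    rw [if_pos hk, h1, entry, dif_pos (by omega)]
    simp only [cOp, LinearMap.coe_mk, AddHom.coe_mk, Nat.sub_sub_self hk]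
    by_cases hk' : k ≤ n / 2
    · rw [if_pos (by omega), if_pos hk', min_eq_right (by omega),
        show n + 1 - k = n - k + 1 by omega, gEntry]
      have h2 := entry_sub_of_mem_palindromic hh (show k ≤ n by omega)
      rcases k with _ | k
      · simp only [Nat.sub_zero] at h2 ⊢
        rw [entry_of_lt _ (Nat.lt_succ_self n), h2, gEntry]; ring
      · have h3 := entry_sub_of_mem_palindromic hh (show k ≤ n by omega)
        rw [show n - (k + 1) + 1 = n - k by omega, h2, h3, gEntry]; ring
    · rw [if_neg hk', min_eq_left (by omega)]
      split_ifs with hk2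
      · ring
      · obtain ⟨m, rfl⟩ : ∃ m, n = 2 * m + 1 := ⟨n / 2, by omega⟩
        obtain rfl : k = m + 1 := by omega
        have h3 := entry_sub_of_mem_palindromic hh (show m ≤ 2 * m + 1 by omega)
        rw [show 2 * m + 1 - m = m + 1 by omega] at h3
        rw [show 2 * m + 1 + 1 - (m + 1) = m + 1 by omega, gEntry, h3]; ring

/-- The coefficients g_k - g_(k-1) of the first summand and g_(k-1) - g_k of the second cancel for k
≤ m = ⌊n/2⌋. At k = m+1 the second leaves g_m. For odd n the first still reaches k = m+1 and
contributes g_(m+1) - g_m = -g_m, since h_(m+1) = h_m; for even n it does not. -/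
theorem toPoly_dOp {n : ℕ} {h : Fin (n + 1) → ℤ} (hh : h ∈ palindromic n) :
    toPoly (n + 2) (dOp n h) = gPoly (n + 1) ((X - 1) * toPoly n h) +
      (X - 1) * gPoly n (toPoly n h) + 2 * gPoly (n + 1) (gPoly n (toPoly n h)) := by
  -- g has degree at most n/2, whereas g in formal degree n+1 reads only coefficients of powers
  -- beyond n/2.
  have h0 : gPoly (n + 1) (gPoly n (toPoly n h)) = 0 := by
    ext k
    rw [coeff_gPoly, coeff_zero]
    split_ifs with hk
    · have : gEntry (fun j => (gPoly n (toPoly n h)).coeff (n + 1 - j)) k =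
          gEntry (fun _ => (0 : ℤ)) k := gEntry_congr fun j hj => by
        rw [coeff_gPoly_toPoly, if_neg (by omega)]
      rw [this]
      cases k <;> simp [gEntry]
    · rfl
  have h1 : ∀ k, (gPoly (n + 1) ((X - 1) * toPoly n h)).coeff k =
      if k ≤ (n + 1) / 2 then gEntry (gEntry (entry h)) k else 0 := by
    intro k
    rw [coeff_gPoly]
    split_ifs with hk
    · exact gEntry_congr fun j hj => coeff_X_sub_one_mul_toPoly hh (by omega)
    · rfl
  ext k
  rw [h0, mul_zero, add_zero, coeff_add, h1, coeff_X_sub_one_mul, coeff_toPoly]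
  simp only [coeff_gPoly_toPoly]
  have hd : (if k ≤ n + 2 then entry (dOp n h) (n + 2 - k) else 0) =
      if Even n ∧ k = n / 2 + 1 then gEntry (entry h) (n / 2) else 0 := by
    by_cases hk : k ≤ n + 2
    · rw [if_pos hk, entry, dif_pos (by omega)]
      simp only [dOp, LinearMap.coe_mk, AddHom.coe_mk]
      refine if_congr (and_congr_right fun he => ?_) rfl rfl
      obtain ⟨m, rfl⟩ := he
      omega
    · rw [if_neg hk, if_neg (by omega)]
  rw [hd]
  rcases k with _ | k
  · simp [gEntry]
  · by_cases hk : k + 1 ≤ n / 2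
    · rw [if_neg (by omega), if_pos (by omega), if_pos hk]
      simp only [if_pos (show k ≤ n / 2 by omega), gEntry]
      ring
    · rw [if_neg hk]
      rcases eq_or_ne k (n / 2) with rfl | hk'
      · rcases Nat.even_or_odd n with he | ho
        · rw [if_pos ⟨he, rfl⟩, if_neg (by obtain ⟨m, rfl⟩ := he; omega)]
          simp
        · rw [if_neg (by simp [ho]), if_pos (by obtain ⟨m, rfl⟩ := ho; omega)]
          obtain ⟨m, rfl⟩ := ho
          have h3 := entry_sub_of_mem_palindromic hh (show m ≤ 2 * m + 1 by omega)
          rw [show 2 * m + 1 - m = m + 1 by omega] at h3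
          simp only [le_refl, if_true, show (2 * m + 1) / 2 = m by omega, gEntry, h3]
          ring
      · rw [if_neg (by omega), if_neg (by omega)]
        simp [show ¬ k ≤ n / 2 by omega]

theorem cOp_mem_palindromic (n : ℕ) (h : Fin (n + 1) → ℤ) : cOp n h ∈ palindromic (n + 1) := by
  intro i
  have : min (i.rev : ℕ) (n + 1 - i.rev) = min (i : ℕ) (n + 1 - i) := by
    simp only [Fin.val_rev]; omega
  simp only [cOp, LinearMap.coe_mk, AddHom.coe_mk, this]

theorem dOp_mem_palindromic (n : ℕ) (h : Fin (n + 1) → ℤ) : dOp n h ∈ palindromic (n + 2) := by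
  intro i
  simp only [dOp, LinearMap.coe_mk, AddHom.coe_mk, Fin.val_rev]
  refine if_congr (and_congr_right fun he => ?_) rfl rfl
  obtain ⟨m, rfl⟩ := he
  omega

/-! ### Comparison of the two actions on formal sums -/

/-- The formal sums of palindromic vectors. -/
def palindromicSums : Submodule ℤ Vectors :=
  ⨆ n, (palindromic n).map (DirectSum.lof ℤ ℕ (fun d => Fin (d + 1) → ℤ) n)

theorem vec_mem_palindromicSums {n : ℕ} {h : Fin (n + 1) → ℤ} (hh : h ∈ palindromic n) :
    vec n h ∈ palindromicSums :=
  Submodule.mem_iSup_of_mem n (Submodule.mem_map_of_mem hh)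

@[elab_as_elim]
theorem palindromicSums_induction {motive : Vectors → Prop}
    (single : ∀ n, ∀ h ∈ palindromic n, motive (vec n h)) (zero : motive 0)
    (add : ∀ v w, motive v → motive w → motive (v + w)) {v : Vectors} (hv : v ∈ palindromicSums) :
    motive v := by
  induction hv using Submodule.iSup_induction' with
  | mem n v hv =>
    obtain ⟨h, hh, rfl⟩ := hv
    exact single n h hh
  | zero => exact zero
  | add v w _ _ hv hw => exact add v w hv hw

/-- Vectors as polynomials. -/
def vectorsToPoly : Vectors →ₗ[ℤ] (ℕ →₀ ℤ[X]) :=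
  DirectSum.toModule ℤ ℕ _ fun n => Finsupp.lsingle n ∘ₗ toPoly n

/-- Polynomials as vectors. -/
def polyToVectors : (ℕ →₀ ℤ[X]) →ₗ[ℤ] Vectors :=
  Finsupp.lsum ℤ fun n => DirectSum.lof ℤ ℕ (fun d => Fin (d + 1) → ℤ) n ∘ₗ ofPoly n

theorem vectorsToPoly_vec (n : ℕ) (h : Fin (n + 1) → ℤ) :
    vectorsToPoly (vec n h) = Finsupp.single n (toPoly n h) := by
  simp [vectorsToPoly, vec]

theorem polyToVectors_single (n : ℕ) (p : ℤ[X]) :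
    polyToVectors (Finsupp.single n p) = vec n (ofPoly n p) := by
  rw [polyToVectors, Finsupp.lsum_single]
  rfl

theorem polyToVectors_vectorsToPoly (v : Vectors) : polyToVectors (vectorsToPoly v) = v := by
  have : polyToVectors ∘ₗ vectorsToPoly = LinearMap.id := by
    refine DirectSum.linearMap_ext ℤ fun n => LinearMap.ext fun h => ?_
    simp only [LinearMap.comp_apply, LinearMap.id_apply]
    rw [vectorsToPoly_vec, polyToVectors_single, ofPoly_toPoly]
  exact LinearMap.congr_fun this v

theorem letterOp_c_vec (n : ℕ) (h : Fin (n + 1) → ℤ) :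
    letterOp CD.c (vec n h) = vec (n + 1) (cOp n h) := by
  simp [letterOp, vec]

theorem letterOp_d_vec (n : ℕ) (h : Fin (n + 1) → ℤ) :
    letterOp CD.d (vec n h) = vec (n + 2) (dOp n h) := by
  simp [letterOp, vec]

theorem letterOp_mem_palindromicSums (l : CD) {v : Vectors} (hv : v ∈ palindromicSums) :
    letterOp l v ∈ palindromicSums := by
  refine palindromicSums_induction (fun n h hh => ?_) ?_ (fun v w hv hw => ?_) hv
  · cases l with
    | c => rw [letterOp_c_vec]; exact vec_mem_palindromicSums (cOp_mem_palindromic n h)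
    | d => rw [letterOp_d_vec]; exact vec_mem_palindromicSums (dOp_mem_palindromic n h)
  · simp
  · rw [map_add]; exact add_mem hv hw

theorem vectorsToPoly_letterOp_c {v : Vectors} (hv : v ∈ palindromicSums) :
    vectorsToPoly (letterOp CD.c v) =
      eOp (vectorsToPoly v) + 2 • bOp (vectorsToPoly v) := by
  refine palindromicSums_induction (fun n h hh => ?_) ?_ (fun v w hv hw => ?_) hv
  · rw [letterOp_c_vec, vectorsToPoly_vec, vectorsToPoly_vec, eOp_single, bOp_single,
      toPoly_cOp hh, two_nsmul, two_mul]
    simp only [Finsupp.single_add]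
  · simp
  · simp only [map_add, hv, hw, smul_add]; abel

theorem vectorsToPoly_letterOp_d {v : Vectors} (hv : v ∈ palindromicSums) :
    vectorsToPoly (letterOp CD.d v) = bOp (eOp (vectorsToPoly v)) + eOp (bOp (vectorsToPoly v)) +
      2 • bOp (bOp (vectorsToPoly v)) := by
  refine palindromicSums_induction (fun n h hh => ?_) ?_ (fun v w hv hw => ?_) hv
  · rw [letterOp_d_vec, vectorsToPoly_vec, vectorsToPoly_vec, eOp_single, bOp_single,
      bOp_single, bOp_single, eOp_single, toPoly_dOp hh, two_nsmul, two_mul]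
    simp only [Finsupp.single_add]
  · simp
  · simp only [map_add, hv, hw, smul_add]; abel

theorem act_add (v : Vectors) (Φ Θ : FreeAlgebra ℤ CD) : act v (Φ + Θ) = act v Φ + act v Θ := by
  simp [act]

theorem act_mul_ι (v : Vectors) (Φ : FreeAlgebra ℤ CD) (l : CD) :
    act v (Φ * FreeAlgebra.ι ℤ l) = letterOp l (act v Φ) := by
  simp [act]

theorem act_algebraMap (v : Vectors) (r : ℤ) : act v (algebraMap ℤ _ r) = r • v := by
  simp only [act, AlgHom.commutes]
  rfl

/-- On cd-polynomials, the action on `(1)` by the operators `c` and `d` agrees with the action that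
yields the toric `h`-polynomial from the ab-index. -/
theorem vectorsToPoly_act (Φ : FreeAlgebra ℤ CD) :
    act (vec 0 ![1]) Φ ∈ palindromicSums ∧
      vectorsToPoly (act (vec 0 ![1]) Φ) = toricOfAb (cdToAb Φ) := by
  have h1 : vec 0 ![1] ∈ palindromicSums := vec_mem_palindromicSums fun i => by
    fin_cases i; rfl
  have h2 : vectorsToPoly (vec 0 ![1]) = Finsupp.single 0 1 := by
    rw [vectorsToPoly_vec]
    simp [toPoly]
  -- The formulas for the letters need palindromic arguments, so palindromicity is carried along in
  -- the induction.
  induction RightGenerated.all Φ with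
  | const r =>
    rw [act_algebraMap, AlgHom.commutes, toricOfAb_algebraMap, map_zsmul, h2]
    exact ⟨Submodule.smul_mem _ _ h1, rfl⟩
  | @append r Φ₁ Φ₂ _ _ ih₁ ih₂ =>
    rw [act_add, act_add, act_mul_ι, act_mul_ι, act_algebraMap]
    refine ⟨add_mem (add_mem (Submodule.smul_mem _ _ h1) (letterOp_mem_palindromicSums _ ih₁.1))
      (letterOp_mem_palindromicSums _ ih₂.1), ?_⟩
    rw [map_add, map_add, vectorsToPoly_letterOp_c ih₁.1, vectorsToPoly_letterOp_d ih₂.1, ih₁.2,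
      ih₂.2, map_zsmul, h2, map_add, map_add, map_mul, map_mul, cdToAb_lc, cdToAb_ld,
      AlgHom.commutes, mul_add, mul_add, ← mul_assoc, ← mul_assoc]
    simp only [toricOfAb_add, toricOfAb_algebraMap, toricOfAb_mul_la, toricOfAb_mul_lb, map_add,
      two_nsmul]
    abel

/-! ### The Euler characteristic of convex sets -/

/-- The sum of the jumps `φ t - φ (t+)` of the step function `φ` is `c`. -/
def HasJumpSum (φ : ℝ → ℤ) (c : ℤ) : Prop :=
  ∃ T₀ : Finset ℝ, ∀ T : Finset ℝ, T₀ ⊆ T → ∀ ε > 0, (∀ s ∈ T, ∀ t ∈ T, s < t → s + ε < t) →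
    ∑ t ∈ T, (φ t - φ (t + ε)) = c

theorem exists_lt_gaps (T : Finset ℝ) : ∃ ε > 0, ∀ s ∈ T, ∀ t ∈ T, s < t → s + ε < t := by
  classical
  have : ∀ p ∈ T ×ˢ T, ∃ ε > 0, p.1 < p.2 → p.1 + ε < p.2 := by
    intro p _
    by_cases h : p.1 < p.2
    · exact ⟨(p.2 - p.1) / 2, by linarith, fun _ => by linarith⟩
    · exact ⟨1, one_pos, fun h' => absurd h' h⟩
  choose! δ hδ hδ' using this
  rcases (T ×ˢ T).eq_empty_or_nonempty with h | h
  · refine ⟨1, one_pos, fun s hs t ht => ?_⟩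
    have : (s, t) ∈ T ×ˢ T := Finset.mk_mem_product hs ht
    simp [h] at this
  · obtain ⟨p, hp, hmin⟩ := Finset.exists_min_image (T ×ˢ T) δ h
    refine ⟨δ p, hδ p hp, fun s hs t ht hst => ?_⟩
    have hm := Finset.mk_mem_product hs ht
    exact (add_le_add_right (hmin _ hm) s).trans_lt (hδ' _ hm hst)

/-- One set T of test points and one ε below all its gaps serve the finitely many φ i at once, and
for fixed T and ε the sum of jumps is linear in φ. -/
theorem sum_eq_zero_of_hasJumpSum {ι : Type*} (s : Finset ι) {φ : ι → ℝ → ℤ} {c a : ι → ℤ}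
    (h : ∀ i ∈ s, HasJumpSum (φ i) (c i)) (h0 : ∀ t, ∑ i ∈ s, a i * φ i t = 0) :
    ∑ i ∈ s, a i * c i = 0 := by
  classical
  choose! T hT using h
  obtain ⟨ε, hε, hgap⟩ := exists_lt_gaps (s.biUnion T)
  have : ∀ i ∈ s, a i * c i = ∑ t ∈ s.biUnion T, (a i * φ i t - a i * φ i (t + ε)) := by
    intro i hi
    rw [← hT i hi _ (Finset.subset_biUnion_of_mem T hi) ε hε hgap, Finset.mul_sum]
    simp only [mul_sub]
  rw [Finset.sum_congr rfl this, Finset.sum_comm]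
  simp [h0]

theorem hasJumpSum_zero : HasJumpSum (fun _ => 0) 0 := ⟨∅, by simp⟩

-- Only right-hand jumps count: a closed interval has one, at its right end.
open Classical in
theorem hasJumpSum_Icc {a b : ℝ} (hab : a ≤ b) (k : ℤ) :
    HasJumpSum (fun t => if t ∈ Set.Icc a b then k else 0) k := by
  refine ⟨{a, b}, fun T hT ε hε hgap => ?_⟩
  have ha : a ∈ T := hT (by simp)
  have hb : b ∈ T := hT (by simp)
  rw [Finset.sum_eq_single_of_mem b hb]
  · simp [hab, hε]
  · intro t ht htb
    have : t ∈ Set.Icc a b ↔ t + ε ∈ Set.Icc a b := by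
      simp only [Set.mem_Icc]
      constructor
      · rintro ⟨h1, h2⟩
        exact ⟨by linarith, (hgap t ht b hb (lt_of_le_of_ne h2 htb)).le⟩
      · rintro ⟨h1, h2⟩
        refine ⟨?_, by linarith⟩
        by_contra! h
        linarith [hgap t ht a ha h]
    simp [this]

-- An open interval jumps to the right only at its left end, and upwards there, hence the sign.
open Classical in
theorem hasJumpSum_Ioo {a b : ℝ} (hab : a < b) (k : ℤ) :
    HasJumpSum (fun t => if t ∈ Set.Ioo a b then k else 0) (-k) := by
  refine ⟨{a, b}, fun T hT ε hε hgap => ?_⟩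
  have ha : a ∈ T := hT (by simp)
  have hb : b ∈ T := hT (by simp)
  rw [Finset.sum_eq_single_of_mem a ha]
  · simp [hε, hgap a ha b hb hab]
  · intro t ht hta
    have : t ∈ Set.Ioo a b ↔ t + ε ∈ Set.Ioo a b := by
      simp only [Set.mem_Ioo]
      constructor
      · rintro ⟨h1, h2⟩
        exact ⟨by linarith, hgap t ht b hb h2⟩
      · rintro ⟨h1, h2⟩
        refine ⟨?_, by linarith⟩
        by_contra! h
        linarith [hgap t ht a ha (lt_of_le_of_ne h hta)]
    simp [this]

section Euler

variable {E : Type*} [NormedAddCommGroup E] [NormedSpace ℝ E]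

/-- `HasEulerChar K c` if `c` is the (combinatorial, i.e. compactly supported) Euler characteristic
of the convex set `K`, for `K` empty, compact, or bounded and relatively open. -/
inductive HasEulerChar : Set E → ℤ → Prop
  | empty : HasEulerChar ∅ 0
  | compact {K : Set E} (hconv : Convex ℝ K) (hK : IsCompact K) (hne : K.Nonempty) :
      HasEulerChar K 1
  | relOpen {K : Set E} (W : Submodule ℝ E) (hconv : Convex ℝ K) (hb : Bornology.IsBounded K)
      (hne : K.Nonempty) (hsub : ∀ x ∈ K, ∀ y ∈ K, x - y ∈ W)
      (hopen : ∀ x ∈ K, ∀ v ∈ W, ∃ ε > (0 : ℝ), x + ε • v ∈ K) :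
      HasEulerChar K ((-1) ^ Module.finrank ℝ W)

theorem finrank_inf_ker [FiniteDimensional ℝ E] {W : Submodule ℝ E} {l : E →L[ℝ] ℝ} {w : E}
    (hw : w ∈ W) (hl : l w ≠ 0) :
    Module.finrank ℝ (W ⊓ (l : E →ₗ[ℝ] ℝ).ker : Submodule ℝ E) + 1 = Module.finrank ℝ W := by
  have h1 : (l : E →ₗ[ℝ] ℝ).domRestrict W ≠ 0 := fun h =>
    hl (by simpa using LinearMap.congr_fun h ⟨w, hw⟩)
  have h2 := Module.Dual.finrank_ker_add_one_of_ne_zero (f := (l : E →ₗ[ℝ] ℝ).domRestrict W) h1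
  rw [← h2, LinearMap.ker_domRestrict, ← Submodule.finrank_map_subtype_eq W,
    Submodule.map_comap_subtype]

open Classical in
/-- The Euler characteristic of a convex set is obtained by integrating that of
its slices with parallel hyperplanes. -/
theorem HasEulerChar.exists_slice [FiniteDimensional ℝ E] {K : Set E} {c : ℤ}
    (h : HasEulerChar K c) (l : E →L[ℝ] ℝ) :
    ∃ φ : ℝ → ℤ, (∀ t, HasEulerChar (K ∩ {x | l x = t}) (φ t)) ∧ HasJumpSum φ c := by
  have hhyp : ∀ t : ℝ, Convex ℝ {x | l x = t} := fun t =>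
    convex_hyperplane (l : E →ₗ[ℝ] ℝ).isLinear t
  cases h with
  | empty => exact ⟨fun _ => 0, fun t => by simpa using HasEulerChar.empty, hasJumpSum_zero⟩
  | compact hconv hK hne =>
    have hconn : IsConnected (l '' K) :=
      (hconv.isConnected hne).image l l.continuous.continuousOn
    have hI := eq_Icc_of_connected_compact hconn (hK.image l.continuous)
    set a := sInf (l '' K)
    set b := sSup (l '' K)
    have hab : a ≤ b := by
      have := hconn.nonempty
      rw [hI] at this
      exact Set.nonempty_Icc.mp this
    refine ⟨_, fun t => ?_, hasJumpSum_Icc hab 1⟩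
    by_cases ht : t ∈ Set.Icc a b
    · simp only [ht, if_true]
      rw [← hI] at ht
      obtain ⟨x, hx, hxt⟩ := ht
      exact .compact (hconv.inter (hhyp t))
        (hK.inter_right (isClosed_eq l.continuous continuous_const)) ⟨x, hx, hxt⟩
    · simp only [ht, if_false]
      rw [← hI] at ht
      convert HasEulerChar.empty (E := E)
      ext x
      simp only [Set.mem_inter_iff, Set.mem_ofPred_eq, Set.mem_empty_iff_false, iff_false]
      exact fun hx => ht ⟨x, hx.1, hx.2⟩
  | relOpen W hconv hb hne hsub hopen =>
    -- If l vanishes on W, then K lies in a single hyperplane and is its own only nonempty slice.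
    by_cases hW : ∀ w ∈ W, l w = 0
    · obtain ⟨x₀, hx₀⟩ := hne
      have hconst : ∀ x ∈ K, l x = l x₀ := fun x hx => by
        have := hW _ (hsub x hx x₀ hx₀)
        rw [map_sub] at this
        linarith
      refine ⟨_, fun t => ?_, hasJumpSum_Icc (le_refl (l x₀)) _⟩
      by_cases ht : t = l x₀
      · have : K ∩ {x | l x = t} = K := by
          ext x
          simp only [Set.mem_inter_iff, Set.mem_ofPred_eq, and_iff_left_iff_imp, ht]
          exact hconst x
        rw [this]
        simp only [ht, Set.Icc_self, Set.mem_singleton_iff, if_true]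
        exact .relOpen W hconv hb ⟨x₀, hx₀⟩ hsub hopen
      · have : K ∩ {x | l x = t} = ∅ := by
          ext x
          simp only [Set.mem_inter_iff, Set.mem_ofPred_eq, Set.mem_empty_iff_false, iff_false]
          exact fun hx => ht (by rw [← hx.2, hconst x hx.1])
        rw [this]
        simp only [ht, Set.Icc_self, Set.mem_singleton_iff, if_false]
        exact .empty
    · push Not at hW
      obtain ⟨w, hwW, hw⟩ := hW
      obtain ⟨w, hwW, hw⟩ : ∃ w ∈ W, 0 < l w := by
        rcases lt_or_gt_of_ne hw with h | h
        · exact ⟨-w, W.neg_mem hwW, by simpa using h⟩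
        · exact ⟨w, hwW, h⟩
      have hbdd : Bornology.IsBounded (l '' K) := l.lipschitz.isBounded_image hb
      have hup : ∀ x ∈ K, ∃ y ∈ K, l x < l y := fun x hx => by
        obtain ⟨ε, hε, h⟩ := hopen x hx w hwW
        exact ⟨_, h, by simp only [map_add, map_smul, smul_eq_mul]; nlinarith⟩
      have hdown : ∀ x ∈ K, ∃ y ∈ K, l y < l x := fun x hx => by
        obtain ⟨ε, hε, h⟩ := hopen x hx (-w) (W.neg_mem hwW)
        exact ⟨_, h, by simp only [map_add, map_smul, map_neg, smul_eq_mul]; nlinarith⟩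
      have hord : (l '' K).OrdConnected :=
        (hconv.is_linear_image (l : E →ₗ[ℝ] ℝ).isLinear).ordConnected
      have hI : ∀ t, t ∈ l '' K ↔ t ∈ Set.Ioo (sInf (l '' K)) (sSup (l '' K)) := by
        intro t
        constructor
        · rintro ⟨x, hx, rfl⟩
          obtain ⟨y, hy, hxy⟩ := hup x hx
          obtain ⟨z, hz, hzx⟩ := hdown x hx
          exact ⟨(csInf_le hbdd.bddBelow ⟨z, hz, rfl⟩).trans_lt hzx,
            hxy.trans_le (le_csSup hbdd.bddAbove ⟨y, hy, rfl⟩)⟩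
        · rintro ⟨h1, h2⟩
          obtain ⟨u, hu, hut⟩ := exists_lt_of_csInf_lt (hne.image l) h1
          obtain ⟨v, hv, htv⟩ := exists_lt_of_lt_csSup (hne.image l) h2
          exact hord.out hu hv ⟨hut.le, htv.le⟩
      have hab : sInf (l '' K) < sSup (l '' K) := by
        obtain ⟨x, hx⟩ := hne
        have := (hI (l x)).mp ⟨x, hx, rfl⟩
        exact this.1.trans this.2
      -- Otherwise l(K) is an open interval and the slices over it lose one dimension. The sign of
      -- the open interval compensates for this.
      have hjump := hasJumpSum_Ioo hab
        ((-1) ^ Module.finrank ℝ (W ⊓ (l : E →ₗ[ℝ] ℝ).ker : Submodule ℝ E))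
      rw [← mul_neg_one ((-1 : ℤ) ^ _), ← pow_succ, finrank_inf_ker hwW hw.ne'] at hjump
      refine ⟨_, fun t => ?_, hjump⟩
      by_cases ht : t ∈ l '' K
      · simp only [(hI t).mp ht, if_true]
        obtain ⟨x, hx, hxt⟩ := ht
        refine .relOpen _ (hconv.inter (hhyp t)) (hb.subset Set.inter_subset_left) ⟨x, hx, hxt⟩
          ?_ ?_
        · rintro x ⟨hx, hxt⟩ y ⟨hy, hyt⟩
          refine ⟨hsub x hx y hy, ?_⟩
          simp only [Set.mem_ofPred_eq] at hxt hyt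
          simp [hxt, hyt]
        · rintro x ⟨hx, hxt⟩ v ⟨hv, hlv⟩
          obtain ⟨ε, hε, h⟩ := hopen x hx v hv
          refine ⟨ε, hε, h, ?_⟩
          have hlv : l v = 0 := hlv
          simp only [Set.mem_ofPred_eq] at hxt
          simp [hxt, hlv]
      · simp only [show ¬ (t ∈ Set.Ioo (sInf (l '' K)) (sSup (l '' K))) from
          fun h => ht ((hI t).mpr h), if_false]
        convert HasEulerChar.empty (E := E)
        ext x
        simp only [Set.mem_inter_iff, Set.mem_ofPred_eq, Set.mem_empty_iff_false, iff_false]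
        exact fun hx => ht ⟨x, hx.1, hx.2⟩

/-- Base case of additivity: a relatively open set with a single point has direction space W = 0, so
its sign is 1. -/
theorem HasEulerChar.eq_ite_of_subsingleton {K : Set E} {c : ℤ} (h : HasEulerChar K c) {p : E}
    (hp : ∀ x ∈ K, x = p) [Decidable (p ∈ K)] : c = if p ∈ K then 1 else 0 := by
  have hmem : K.Nonempty → p ∈ K := fun ⟨x, hx⟩ => hp x hx ▸ hx
  cases h with
  | empty => simp
  | compact _ _ hne => rw [if_pos (hmem hne)]
  | relOpen W _ _ hne _ hopen =>
    rw [if_pos (hmem hne)]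
    have : W = ⊥ := by
      rw [Submodule.eq_bot_iff]
      intro v hv
      obtain ⟨ε, hε, h⟩ := hopen p (hmem hne) v hv
      have := hp _ h
      rw [add_eq_left, smul_eq_zero] at this
      exact this.resolve_left hε.ne'
    rw [this, finrank_bot, pow_zero]

open Classical in
/-- The Euler characteristic is additive: a linear relation between the indicator
functions of sets implies the same relation between their Euler characteristics. -/
theorem sum_eq_zero_of_hasEulerChar [FiniteDimensional ℝ E] {ι : Type*} (s : Finset ι)
    (a : ι → ℤ) {K : ι → Set E} {c : ι → ℤ} (hK : ∀ i ∈ s, HasEulerChar (K i) (c i))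
    (h0 : ∀ x, ∑ i ∈ s, a i * (if x ∈ K i then 1 else 0) = 0) : ∑ i ∈ s, a i * c i = 0 := by
  -- Induction on the dimension of a space W containing all differences of points of the sets.
  -- Slicing by a functional that is nonzero on W replaces W by its intersection with the kernel.
  suffices H : ∀ (n : ℕ) (W : Submodule ℝ E), Module.finrank ℝ W = n → ∀ (K : ι → Set E)
      (c : ι → ℤ), (∀ i ∈ s, HasEulerChar (K i) (c i)) →
      (∀ i ∈ s, ∀ j ∈ s, ∀ x ∈ K i, ∀ y ∈ K j, x - y ∈ W) →
      (∀ x, ∑ i ∈ s, a i * (if x ∈ K i then 1 else 0) = 0) → ∑ i ∈ s, a i * c i = 0 from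
    H _ ⊤ rfl K c hK (fun _ _ _ _ _ _ _ _ => Submodule.mem_top) h0
  intro n
  induction n with
  | zero =>
    intro W hW K c hK hsub h0
    obtain rfl : W = ⊥ := Submodule.finrank_eq_zero.mp hW
    by_cases hne : ∃ i ∈ s, (K i).Nonempty
    · obtain ⟨i, hi, p, hp⟩ := hne
      rw [← h0 p]
      refine Finset.sum_congr rfl fun j hj => ?_
      rw [(hK j hj).eq_ite_of_subsingleton (p := p) fun x hx => ?_]
      have := hsub j hj i hi x hx p hp
      rwa [Submodule.mem_bot, sub_eq_zero] at this
    · push Not at hne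
      refine Finset.sum_eq_zero fun i hi => ?_
      rw [(hK i hi).eq_ite_of_subsingleton (p := 0) (by simp [hne i hi])]
      simp [hne i hi]
  | succ n ih =>
    intro W hW K c hK hsub h0
    obtain ⟨w, hwW, hw⟩ : ∃ w ∈ W, w ≠ 0 := by
      by_contra! h
      rw [(Submodule.eq_bot_iff W).mpr h, finrank_bot] at hW
      omega
    obtain ⟨l, hl⟩ := SeparatingDual.exists_ne_zero (R := ℝ) hw
    have hW' := finrank_inf_ker hwW hl
    choose! φ hφ hφ' using fun i hi => (hK i hi).exists_slice l
    refine sum_eq_zero_of_hasJumpSum s hφ' fun t => ?_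
    refine ih (W ⊓ (l : E →ₗ[ℝ] ℝ).ker) (by omega) (fun i => K i ∩ {x | l x = t}) (fun i => φ i t)
      (fun i hi => hφ i hi t) ?_ fun x => ?_
    · rintro i hi j hj x ⟨hx, hxt⟩ y ⟨hy, hyt⟩
      refine ⟨hsub i hi j hj x hx y hy, ?_⟩
      simp only [Set.mem_ofPred_eq] at hxt hyt
      simp [hxt, hyt]
    · by_cases hx : l x = t
      · simpa [hx] using h0 x
      · simp [hx]

open Classical in
theorem sub_eq_sum_of_hasEulerChar [FiniteDimensional ℝ E] {ι : Type*} (s : Finset ι)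
    {K L : Set E} {k l : ℤ} (hK : HasEulerChar K k) (hL : HasEulerChar L l)
    {U : ι → Set E} {u : ι → ℤ} (hU : ∀ i ∈ s, HasEulerChar (U i) (u i))
    (h : ∀ x, (if x ∈ K then 1 else 0) - (if x ∈ L then 1 else 0) =
      ∑ i ∈ s, if x ∈ U i then (1 : ℤ) else 0) : k - l = ∑ i ∈ s, u i := by
  have := sum_eq_zero_of_hasEulerChar (E := E) (Finset.insertNone (Finset.insertNone s))
    (fun | none => 1 | some none => -1 | some (some _) => -1)
    (K := fun | none => K | some none => L | some (some i) => U i)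
    (c := fun | none => k | some none => l | some (some i) => u i)
    (by
      rintro (_ | _ | i) hi
      · exact hK
      · exact hL
      · exact hU i (by simpa using hi)) (fun x => by
        simp only [Finset.sum_insertNone]
        have := h x
        simp only [one_mul, neg_one_mul, Finset.sum_neg_distrib]
        linarith)
  simp only [Finset.sum_insertNone, one_mul, neg_one_mul, Finset.sum_neg_distrib] at this
  linarith

end Euler

/-! ### Faces of polytopes -/

section Faces

variable {E : Type*} [NormedAddCommGroup E] [NormedSpace ℝ E]

theorem toNat_dim (A : Set E) : (dim A).toNat = Module.finrank ℝ (vectorSpan ℝ A) := by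
  unfold dim
  split_ifs with h
  · rw [h, vectorSpan_empty, finrank_bot]; rfl
  · simp

theorem dim_of_nonempty {A : Set E} (h : A.Nonempty) : dim A = (dim A).toNat := by
  rw [toNat_dim, dim, if_neg h.ne_empty]

/-- Convex hulls of finite sets. -/
def IsFiniteHull (P : Set E) : Prop :=
  ∃ S : Finset E, P = convexHull ℝ (S : Set E)

namespace IsFiniteHull

variable {P F G : Set E}

theorem isCompact (hP : IsFiniteHull P) : IsCompact P := by
  obtain ⟨S, rfl⟩ := hP
  exact S.finite_toSet.isCompact_convexHull ℝ

theorem convex (hP : IsFiniteHull P) : Convex ℝ P := by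
  obtain ⟨S, rfl⟩ := hP
  exact convex_convexHull ℝ _

/-- Krein–Milman: extreme points of F are extreme in the whole polytope, hence lie in S. They are
finitely many, so their convex hull is already closed. -/
theorem face_eq_convexHull {S : Finset E}
    (hF : IsExposed ℝ (convexHull ℝ (S : Set E)) F) : F = convexHull ℝ ((S : Set E) ∩ F) := by
  have hP : IsFiniteHull (convexHull ℝ (S : Set E)) := ⟨S, rfl⟩
  have hconv := hF.convex hP.convex
  refine Set.Subset.antisymm ?_ (convexHull_min Set.inter_subset_right hconv)
  have hext : F.extremePoints ℝ ⊆ (S : Set E) ∩ F := fun x hx =>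
    ⟨extremePoints_convexHull_subset (hF.isExtreme.extremePoints_subset_extremePoints hx),
      extremePoints_subset hx⟩
  have hfin : (F.extremePoints ℝ).Finite := (S.finite_toSet.inter_of_left F).subset hext
  have hKM := closure_convexHull_extremePoints (hF.isCompact hP.isCompact) hconv
  rw [(hfin.isCompact_convexHull ℝ).isClosed.closure_eq] at hKM
  exact hKM.symm.subset.trans (convexHull_mono hext)

theorem face (hP : IsFiniteHull P) (hF : IsExposed ℝ P F) : IsFiniteHull F := by
  obtain ⟨S, rfl⟩ := hP
  classical
  refine ⟨S.filter (· ∈ F), ?_⟩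
  have := face_eq_convexHull hF
  convert this using 2
  ext x
  simp

theorem finite_faces (hP : IsFiniteHull P) : {F | IsExposed ℝ P F}.Finite := by
  obtain ⟨S, rfl⟩ := hP
  refine Set.Finite.of_finite_image (f := fun F => (S : Set E) ∩ F)
    (S.finite_toSet.finite_subsets.subset ?_) ?_
  · rintro _ ⟨F, _, rfl⟩
    exact Set.inter_subset_left
  · intro F hF G hG h
    have h : (S : Set E) ∩ F = (S : Set E) ∩ G := h
    rw [face_eq_convexHull hF, face_eq_convexHull hG, h]

/-- If l exposes G in P and m exposes F in G, then N l + m exposes F in P for large N: at the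
finitely many generators outside G the deficit of l outweighs any gain of m. -/
theorem isExposed_trans (hP : IsFiniteHull P) (hG : IsExposed ℝ P G) (hF : IsExposed ℝ G F) :
    IsExposed ℝ P F := by
  rintro ⟨x, hxF⟩
  have hxG := hF.subset hxF
  obtain ⟨S, rfl⟩ := hP
  obtain ⟨l, hl⟩ := hG ⟨x, hxG⟩
  obtain ⟨m, hm⟩ := hF ⟨x, hxF⟩
  have hxG' := hxG
  have hxF' := hxF
  rw [hl] at hxG'
  rw [hm] at hxF'
  have hlt : ∀ s ∈ S, s ∉ G → l s < l x := fun s hs hsG => by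
    by_contra! h
    apply hsG
    rw [hl]
    exact ⟨subset_convexHull ℝ _ hs, fun y hy => (hxG'.2 y hy).trans h⟩
  obtain ⟨N, hN⟩ : ∃ N : ℝ, ∀ s ∈ S, s ∉ G → m s - m x < N * (l x - l s) := by
    have : ∀ᶠ N : ℝ in Filter.atTop, ∀ s ∈ S, s ∉ G → m s - m x < N * (l x - l s) := by
      rw [Filter.eventually_all_finset]
      intro s hs
      by_cases hsG : s ∈ G
      · simp [hsG]
      · have := (Filter.tendsto_id.atTop_mul_const
          (sub_pos.mpr (hlt s hs hsG))).eventually_gt_atTop (m s - m x)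
        filter_upwards [this] with N hN _ using hN
    exact this.exists
  set k : E →L[ℝ] ℝ := N • l + m
  have hk : ∀ y, k y = N * l y + m y := fun y => rfl
  have hlG : ∀ y ∈ G, l y = l x := fun y hy => by
    rw [hl] at hy
    exact le_antisymm (hxG'.2 y hy.1) (hy.2 x hxG'.1)
  have hS : ∀ s ∈ S, k s ≤ k x := fun s hs => by
    rw [hk, hk]
    by_cases hsG : s ∈ G
    · rw [hlG s hsG]
      linarith [hxF'.2 s hsG]
    · linarith [hN s hs hsG]
  have hmax : ∀ y ∈ convexHull ℝ (S : Set E), k y ≤ k x := fun y hy =>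
    convexHull_min (t := {y | k y ≤ k x}) hS
      (convex_halfSpace_le (k : E →ₗ[ℝ] ℝ).isLinear _) hy
  refine ⟨k, Set.Subset.antisymm (fun y hy => ?_) ?_⟩
  · refine ⟨hG.subset (hF.subset hy), fun z hz => (hmax z hz).trans ?_⟩
    rw [hk, hk, hlG y (hF.subset hy)]
    rw [hm] at hy
    linarith [hy.2 x hxG]
  · have hexp : IsExposed ℝ (convexHull ℝ (S : Set E)) (k.toExposed (convexHull ℝ (S : Set E))) :=
      ContinuousLinearMap.toExposed.isExposed
    have hFconv : Convex ℝ F := hF.convex (hG.convex (convex_convexHull ℝ _))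
    change k.toExposed (convexHull ℝ (S : Set E)) ⊆ F
    rw [face_eq_convexHull hexp]
    refine convexHull_min ?_ hFconv
    rintro s ⟨hsS, hsP, hs⟩
    have hs := hs x hxG'.1
    rw [hk, hk] at hs
    by_cases hsG : s ∈ G
    · rw [hlG s hsG] at hs
      rw [hm]
      exact ⟨hsG, fun y hy => (hxF'.2 y hy).trans (by linarith)⟩
    · linarith [hN s hsS hsG]

end IsFiniteHull

/-! ### Relative interiors of faces -/

/-- The relative interior of the face `G` of the polytope `P`. -/
def relInt (P G : Set E) : Set E :=
  {x | x ∈ G ∧ ∀ G', IsExposed ℝ P G' → x ∈ G' → G ⊆ G'}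

section RelInt

variable {P F G : Set E}

/-- The intersection of the finitely many faces through x is the smallest such face. With
`eq_of_mem_relInt` this partitions P into relative interiors. -/
theorem exists_mem_relInt (hP : IsFiniteHull P) {x : E} (hx : x ∈ P) :
    ∃ G, IsExposed ℝ P G ∧ x ∈ relInt P G := by
  classical
  have hfin : {F | IsExposed ℝ P F ∧ x ∈ F}.Finite := hP.finite_faces.subset fun F hF => hF.1
  have hne : hfin.toFinset.Nonempty := ⟨P, by simp [hx, IsExposed.refl]⟩
  refine ⟨⋂₀ (hfin.toFinset : Set (Set E)),
    IsExposed.sInter hne fun F hF => ((hfin.mem_toFinset).mp hF).1, ?_, ?_⟩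
  · intro F hF
    exact ((hfin.mem_toFinset).mp hF).2
  · intro F hF hxF
    exact Set.sInter_subset_of_mem ((hfin.mem_toFinset).mpr ⟨hF, hxF⟩)

theorem eq_of_mem_relInt {x : E} (hF : IsExposed ℝ P F) (hG : IsExposed ℝ P G)
    (hxF : x ∈ relInt P F) (hxG : x ∈ relInt P G) : F = G :=
  Set.Subset.antisymm (hxF.2 G hG hxG.1) (hxG.2 F hF hxF.1)

/-- A face that contains an inner point of a segment contains its endpoint x, and therefore G. -/
theorem combo_mem_relInt (hP : Convex ℝ P) (hG : IsExposed ℝ P G) {x y : E}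
    (hx : x ∈ relInt P G) (hy : y ∈ G) {a b : ℝ} (ha : 0 < a) (hb : 0 ≤ b) (hab : a + b = 1) :
    a • x + b • y ∈ relInt P G := by
  refine ⟨hG.convex hP hx.1 hy ha.le hb hab, fun G' hG' h => ?_⟩
  refine hx.2 G' hG' ?_
  rcases hb.eq_or_lt with rfl | hb
  · obtain rfl : a = 1 := by linarith
    simpa using h
  · exact hG'.isExtreme.left_mem_of_mem_openSegment (hG.subset hx.1) (hG.subset hy) h
      ⟨a, b, ha, hb, hab, rfl⟩

/-- Take F maximal among the faces inside G with nonempty relative interior, x in that interior, and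
y in G. The smallest face through the midpoint of x and y contains F and y, so by maximality y lies
in F. -/
theorem relInt_nonempty (hP : IsFiniteHull P) (hG : IsExposed ℝ P G) (hne : G.Nonempty) :
    (relInt P G).Nonempty := by
  have hfin : {F | IsExposed ℝ P F ∧ F ⊆ G ∧ (relInt P F).Nonempty}.Finite :=
    hP.finite_faces.subset fun F hF => hF.1
  have hne' : {F | IsExposed ℝ P F ∧ F ⊆ G ∧ (relInt P F).Nonempty}.Nonempty := by
    obtain ⟨x, hx⟩ := hne
    obtain ⟨F, hF, hxF⟩ := exists_mem_relInt hP (hG.subset hx)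
    exact ⟨F, hF, hxF.2 G hG hx, x, hxF⟩
  obtain ⟨F, ⟨hF, hFG, x, hx⟩, hmax⟩ := hfin.exists_maximal hne'
  suffices h : F = G by rw [← h]; exact ⟨x, hx⟩
  refine Set.Subset.antisymm hFG fun y hy => ?_
  have hz : (1 / 2 : ℝ) • x + (1 / 2 : ℝ) • y ∈ G :=
    hG.convex hP.convex (hFG hx.1) hy (by norm_num) (by norm_num) (by norm_num)
  obtain ⟨F', hF', hzF'⟩ := exists_mem_relInt hP (hG.subset hz)
  have hseg : (1 / 2 : ℝ) • x + (1 / 2 : ℝ) • y ∈ openSegment ℝ x y :=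
    ⟨1 / 2, 1 / 2, by norm_num, by norm_num, by norm_num, rfl⟩
  have hxF' := hF'.isExtreme.left_mem_of_mem_openSegment (hF.subset hx.1) (hG.subset hy)
    hzF'.1 hseg
  have hyF' := hF'.isExtreme.right_mem_of_mem_openSegment (hF.subset hx.1) (hG.subset hy)
    hzF'.1 hseg
  exact hmax ⟨hF', hzF'.2 G hG hz, _, hzF'⟩ (hx.2 F' hF' hxF') hyF'

/-- A point of a finite-dimensional convex set, at which no linear functional attains its
maximum over the set unless it is constant on it, lies in the relative interior. -/
theorem exists_add_smul_mem [FiniteDimensional ℝ E] (hG : Convex ℝ G) {x : E} (hx : x ∈ G)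
    (H : ∀ g : E →L[ℝ] ℝ, (∀ y ∈ G, g y ≤ g x) → ∀ y ∈ G, g y = g x) {v : E}
    (hv : v ∈ vectorSpan ℝ G) : ∃ ε > (0 : ℝ), x + ε • v ∈ G := by
  set W := vectorSpan ℝ G with hW
  -- Translated into its own direction space, G has nonempty interior.
  set C : Set W := {w | x + (w : E) ∈ G} with hC
  have hCconv : Convex ℝ C := by
    intro u hu w hw a b ha hb hab
    have := hG hu hw ha hb hab
    simp only [hC, Set.mem_ofPred_eq]
    convert this using 1
    have : x = a • x + b • x := by rw [← add_smul, hab, one_smul]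
    conv_lhs => rw [this]
    simp only [Submodule.coe_add, Submodule.coe_smul, smul_add]
    abel
  have h0 : (0 : W) ∈ C := by simpa [hC] using hx
  have hspan : affineSpan ℝ C = ⊤ := by
    rw [AffineSubspace.affineSpan_eq_top_iff_vectorSpan_eq_top_of_nonempty ℝ W W ⟨0, h0⟩]
    have hle : W ≤ (vectorSpan ℝ C).map W.subtype := by
      conv_lhs => rw [hW, vectorSpan_eq_span_vsub_set_right ℝ hx]
      rw [Submodule.span_le]
      rintro _ ⟨g, hg, rfl⟩
      refine ⟨⟨g - x, vsub_mem_vectorSpan ℝ hg hx⟩, ?_, rfl⟩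
      have h1 : (⟨g - x, vsub_mem_vectorSpan ℝ hg hx⟩ : W) ∈ C := by simpa [hC] using hg
      simpa using vsub_mem_vectorSpan ℝ h1 h0
    rw [eq_top_iff]
    rintro w -
    obtain ⟨u, hu, huw⟩ := hle w.2
    rwa [← Subtype.ext (a1 := u) (a2 := w) huw]
  have hint : (interior C).Nonempty := hCconv.interior_nonempty_iff_affineSpan_eq_top.mpr hspan
  by_cases h : (0 : W) ∈ interior C
  · have hcont : Filter.Tendsto (fun ε : ℝ => ε • (⟨v, hv⟩ : W)) (nhdsWithin 0 (Set.Ioi 0))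
        (nhds 0) := by
      have : Continuous fun ε : ℝ => ε • (⟨v, hv⟩ : W) := by fun_prop
      have := this.tendsto 0
      rw [zero_smul] at this
      exact this.mono_left nhdsWithin_le_nhds
    have h1 := hcont.eventually (mem_interior_iff_mem_nhds.mp h)
    obtain ⟨ε, hε, hε0⟩ := (h1.and self_mem_nhdsWithin).exists
    exact ⟨ε, hε0, hε⟩
  · exfalso
    -- A separating functional, extended to E, attains its maximum over G at x, so by `H` it is
    -- constant on G. Yet it is strictly negative on the interior of C.
    obtain ⟨f, hf⟩ := geometric_hahn_banach_open_point hCconv.interior isOpen_interior h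
    obtain ⟨g, hg, -⟩ := exists_extension_norm_eq W f
    have hfC : ∀ w ∈ C, f w ≤ 0 := by
      have hcl : closure (interior C) ⊆ {w | f w ≤ 0} :=
        closure_minimal (fun w hw => by simpa using (hf w hw).le)
          (isClosed_le f.continuous continuous_const)
      intro w hw
      apply hcl
      rw [hCconv.closure_interior_eq_closure_of_nonempty_interior hint]
      exact subset_closure hw
    have hgG : ∀ y, ∀ hy : y ∈ G, g y = g x + f ⟨y - x, vsub_mem_vectorSpan ℝ hy hx⟩ := by
      intro y hy
      rw [← hg, ← map_add]
      simp
    have hconst := H g fun y hy => by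
      rw [hgG y hy]
      have := hfC ⟨y - x, vsub_mem_vectorSpan ℝ hy hx⟩ (by simpa [hC] using hy)
      linarith
    obtain ⟨w, hw⟩ := hint
    have hwC : w ∈ C := interior_subset hw
    have hwG : x + (w : E) ∈ G := hwC
    have h1 := hconst _ hwG
    rw [map_add, hg] at h1
    have h2 := hf w hw
    rw [map_zero] at h2
    linarith

/-- A functional maximal at x exposes a face of G, which is also a face of P. It contains x, hence
all of G, so the functional is constant on G. -/
theorem exists_add_smul_mem_face [FiniteDimensional ℝ E] (hP : IsFiniteHull P)
    (hG : IsExposed ℝ P G) {x v : E} (hx : x ∈ relInt P G) (hv : v ∈ vectorSpan ℝ G) :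
    ∃ ε > (0 : ℝ), x + ε • v ∈ G := by
  refine exists_add_smul_mem (hG.convex hP.convex) hx.1 (fun g hg y hy => ?_) hv
  have hexp : IsExposed ℝ G (g.toExposed G) := ContinuousLinearMap.toExposed.isExposed
  have := hx.2 _ (hP.isExposed_trans hG hexp) ⟨hx.1, hg⟩ hy
  exact le_antisymm (hg y hy) (this.2 x hx.1)

theorem exists_add_smul_mem_relInt [FiniteDimensional ℝ E] (hP : IsFiniteHull P)
    (hG : IsExposed ℝ P G) {x v : E} (hx : x ∈ relInt P G) (hv : v ∈ vectorSpan ℝ G) :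
    ∃ ε > (0 : ℝ), ∀ r : ℝ, 0 ≤ r → r ≤ 1 → x + (r * ε) • v ∈ relInt P G := by
  obtain ⟨ε, hε, h⟩ := exists_add_smul_mem_face hP hG hx hv
  -- Halving ε leaves the weight 1 - r/2 > 0 on x, which keeps the point in the relative interior.
  refine ⟨ε / 2, by positivity, fun r hr0 hr1 => ?_⟩
  have := combo_mem_relInt hP.convex hG hx h (a := 1 - r / 2) (b := r / 2) (by linarith)
    (by linarith) (by ring)
  convert this using 1
  module

theorem convex_relInt (hP : Convex ℝ P) (hG : IsExposed ℝ P G) : Convex ℝ (relInt P G) := by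
  intro x hx y hy a b ha hb hab
  rcases ha.eq_or_lt with rfl | ha
  · obtain rfl : b = 1 := by linarith
    simpa using hy
  · exact combo_mem_relInt hP hG hx hy.1 ha hb hab

theorem isBounded_relInt (hP : IsFiniteHull P) (hG : IsExposed ℝ P G) :
    Bornology.IsBounded (relInt P G) :=
  hP.isCompact.isBounded.subset fun _ hx => hG.subset hx.1

theorem hasEulerChar_relInt [FiniteDimensional ℝ E] (hP : IsFiniteHull P) (hG : IsExposed ℝ P G)
    (hne : G.Nonempty) : HasEulerChar (relInt P G) ((-1) ^ (dim G).toNat) := by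
  rw [toNat_dim]
  refine .relOpen _ (convex_relInt hP.convex hG) (isBounded_relInt hP hG)
    (relInt_nonempty hP hG hne) (fun x hx y hy => vsub_mem_vectorSpan ℝ hx.1 hy.1)
    fun x hx v hv => ?_
  obtain ⟨ε, hε, h⟩ := exists_add_smul_mem_relInt hP hG hx hv
  exact ⟨ε, hε, by simpa using h 1 zero_le_one le_rfl⟩

/-! ### Euler's relations for the face lattice -/

/-- The nonempty faces of a polytope. -/
def nonemptyFaces (P : Set E) : Finset (Set E) :=
  open Classical in
  if h : {F | IsExposed ℝ P F ∧ F.Nonempty}.Finite then h.toFinset else ∅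

theorem mem_nonemptyFaces (hP : IsFiniteHull P) :
    F ∈ nonemptyFaces P ↔ IsExposed ℝ P F ∧ F.Nonempty := by
  have h : {F | IsExposed ℝ P F ∧ F.Nonempty}.Finite := hP.finite_faces.subset fun F hF => hF.1
  rw [nonemptyFaces, dif_pos h]
  simp

/-- **Euler's relation** for polytopes. -/
theorem sum_nonemptyFaces [FiniteDimensional ℝ E] (hP : IsFiniteHull P) (hne : P.Nonempty) :
    ∑ G ∈ nonemptyFaces P, (-1 : ℤ) ^ (dim G).toNat = 1 := by
  classical
  have := sub_eq_sum_of_hasEulerChar (nonemptyFaces P) (.compact hP.convex hP.isCompact hne)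
    (.empty (E := E)) (U := fun G => relInt P G) (u := fun G => (-1) ^ (dim G).toNat)
    (fun G hG => by
      rw [mem_nonemptyFaces hP] at hG
      exact hasEulerChar_relInt hP hG.1 hG.2) fun x => ?_
  · rw [← this, sub_zero]
  · by_cases hx : x ∈ P
    · obtain ⟨G, hG, hxG⟩ := exists_mem_relInt hP hx
      rw [Finset.sum_eq_single_of_mem G ((mem_nonemptyFaces hP).mpr ⟨hG, x, hxG.1⟩)]
      · simp [hx, hxG]
      · intro F hF hFG
        rw [if_neg fun h => hFG (eq_of_mem_relInt ((mem_nonemptyFaces hP).mp hF).1 hG h hxG)]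
    · rw [Finset.sum_eq_zero]
      · simp [hx]
      · intro F hF
        rw [if_neg fun h => hx (((mem_nonemptyFaces hP).mp hF).1.subset h.1)]

/-- The relative interior of a face `G ⊇ F` meets each complement of `F` through a
point `x` of the relative interior of `F`, near `x`. -/
theorem exists_add_smul_mem_relInt_of_subset [FiniteDimensional ℝ E] (hP : IsFiniteHull P)
    (hF : IsExposed ℝ P F) (hG : IsExposed ℝ P G) (hFG : F ⊆ G) {x : E} (hx : x ∈ relInt P F)
    {N : Submodule ℝ E} (hN : IsCompl (vectorSpan ℝ F) N) :
    ∃ v ∈ N, ∀ r : ℝ, 0 < r → r ≤ 1 → x + r • v ∈ relInt P G := by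
  obtain ⟨y, hy⟩ := relInt_nonempty hP hG ⟨x, hFG hx.1⟩
  have hmem : y - x ∈ vectorSpan ℝ F ⊔ N := by rw [hN.sup_eq_top]; trivial
  obtain ⟨f, hf, n, hn, hfn⟩ := Submodule.mem_sup.mp hmem
  -- The weights ε/(1+ε) on y = x+f+n and 1/(1+ε) on x-εf cancel the component f along F and leave a
  -- positive multiple of n.
  obtain ⟨ε, hε, h⟩ := exists_add_smul_mem_face hP hF hx (neg_mem hf)
  have hz : x + (ε / (1 + ε)) • n ∈ relInt P G := by
    have := combo_mem_relInt hP.convex hG hy (hFG h) (a := ε / (1 + ε)) (b := 1 / (1 + ε))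
      (by positivity) (by positivity) (by field_simp; ring)
    convert this using 1
    have hy' : y = x + (f + n) := by rw [hfn]; abel
    have h1 : (1 / (1 + ε)) * ε = ε / (1 + ε) := by ring
    have h2 : x = (ε / (1 + ε)) • x + (1 / (1 + ε)) • x := by
      rw [← add_smul, show ε / (1 + ε) + 1 / (1 + ε) = 1 by field_simp; ring, one_smul]
    rw [hy']
    conv_lhs => rw [h2]
    simp only [smul_add, smul_neg, smul_smul, h1]
    abel
  refine ⟨(ε / (1 + ε)) • n, N.smul_mem _ hn, fun r hr0 hr1 => ?_⟩
  have := combo_mem_relInt hP.convex hG hz (hFG hx.1) hr0 (sub_nonneg.mpr hr1) (by ring)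
  convert this using 1
  module

theorem exists_mul_abs_lt {δ : ℝ} (hδ : 0 < δ) (k : ℝ) : ∃ r, 0 < r ∧ r ≤ 1 ∧ r * |k| < δ := by
  have hk := abs_nonneg k
  refine ⟨δ / (δ + |k|), by positivity, (div_le_one (by positivity)).mpr (by linarith), ?_⟩
  rw [div_mul_eq_mul_div, div_lt_iff₀ (by positivity)]
  nlinarith

theorem finrank_inf_add_finrank_of_isCompl [FiniteDimensional ℝ E] {D N V : Submodule ℝ E}
    (hN : IsCompl D N) (hDV : D ≤ V) :
    Module.finrank ℝ (V ⊓ N : Submodule ℝ E) + Module.finrank ℝ D = Module.finrank ℝ V := by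
  have h1 : D ⊔ (V ⊓ N) = V := by
    rw [inf_comm, ← sup_inf_assoc_of_le N hDV, hN.sup_eq_top, top_inf_eq]
  have h2 : D ⊓ (V ⊓ N) = ⊥ := by
    rw [eq_bot_iff, ← hN.inf_eq_bot]
    exact inf_le_inf_left _ inf_le_right
  have := Submodule.finrank_sup_add_finrank_inf_eq D (V ⊓ N)
  rw [h1, h2, finrank_bot] at this
  omega

open Filter Topology in
/-- **Euler's relation** for the upper intervals of the face lattice. -/
theorem sum_nonemptyFaces_superset [FiniteDimensional ℝ E] [DecidableLE (Set E)]
    (hP : IsFiniteHull P) (hF : IsExposed ℝ P F) (hne : F.Nonempty) (hFP : F ≠ P) :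
    ∑ G ∈ nonemptyFaces P with F ≤ G, (-1 : ℤ) ^ (dim G).toNat = 0 := by
  classical
  obtain ⟨x, hx⟩ := relInt_nonempty hP hF hne
  obtain ⟨l, hl⟩ := hF hne
  obtain ⟨N, hN⟩ := Submodule.exists_isCompl (vectorSpan ℝ F)
  have hxP : x ∈ P := hF.subset hx.1
  have hxmax : ∀ y ∈ P, l y ≤ l x := by
    have := hx.1
    rw [hl] at this
    exact this.2
  have hltF : ∀ y ∈ P, y ∉ F → l y < l x := fun y hy hyF => by
    by_contra! h
    apply hyF
    rw [hl]
    exact ⟨hy, fun z hz => (hxmax z hz).trans h⟩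
  -- The affine space A through x is complementary to F and meets it only in x. Cutting P ∩ A just
  -- below x gives a cap in which only faces containing F appear, with dimensions lowered by dim F.
  set A : Set E := {y | y - x ∈ N} with hA
  have hAconv : Convex ℝ A := by
    intro u hu v hv a b ha hb hab
    have : a • u + b • v - x = a • (u - x) + b • (v - x) := by
      have h1 : x = a • x + b • x := by rw [← add_smul, hab, one_smul]
      conv_lhs => rw [h1]
      module
    simp only [hA, Set.mem_ofPred_eq, this]
    exact N.add_mem (N.smul_mem _ hu) (N.smul_mem _ hv)
  have hAclosed : IsClosed A :=
    N.closed_of_finiteDimensional.preimage (f := fun y => y - x) (by fun_prop)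
  have hxA : x ∈ A := by simp [hA]
  have hFA : ∀ y ∈ F, y ∈ A → y = x := fun y hy hyA => by
    have : y - x ∈ vectorSpan ℝ F ⊓ N := ⟨vsub_mem_vectorSpan ℝ hy hx.1, hyA⟩
    rwa [hN.inf_eq_bot, Submodule.mem_bot, sub_eq_zero] at this
  obtain ⟨v₀, hv₀, h₀⟩ :=
    exists_add_smul_mem_relInt_of_subset hP hF (IsExposed.refl P) hF.subset hx hN
  have hp := h₀ 1 one_pos le_rfl
  rw [one_smul] at hp
  have hpA : x + v₀ ∈ A := by simpa [hA] using hv₀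
  have hpl : l (x + v₀) < l x := hltF _ hp.1 fun h =>
    hFP (Set.Subset.antisymm hF.subset (hp.2 F hF h))
  -- A face not containing F misses x, so by compactness l stays below l x by a positive amount on
  -- its intersection with A. The bound by l (x + v₀) makes the section at level t nonempty.
  obtain ⟨t, htx, htp, htG⟩ : ∃ t < l x, l (x + v₀) < t ∧
      ∀ G ∈ nonemptyFaces P, ¬ F ⊆ G → ∀ y ∈ G ∩ A, l y < t := by
    have h1 : ∀ᶠ t in 𝓝[<] (l x), ∀ G ∈ nonemptyFaces P, ¬ F ⊆ G → ∀ y ∈ G ∩ A, l y < t := by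
      rw [eventually_all_finset]
      intro G hG
      rw [mem_nonemptyFaces hP] at hG
      by_cases hFG : F ⊆ G
      · simp [hFG]
      rcases (G ∩ A).eq_empty_or_nonempty with he | hne'
      · simp [he]
      obtain ⟨y, hy, hmax⟩ := ((hG.1.isCompact hP.isCompact).inter_right hAclosed).exists_isMaxOn
        hne' l.continuous.continuousOn
      have hyx : l y < l x := hltF y (hG.1.subset hy.1) fun hyF => by
        rw [hFA y hyF hy.2] at hy
        exact hFG (hx.2 G hG.1 hy.1)
      filter_upwards [Ioo_mem_nhdsLT hyx] with t ht _ z hz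
      exact (hmax hz).trans_lt ht.1
    obtain ⟨t, ht, ht'⟩ := (h1.and (Ioo_mem_nhdsLT hpl)).exists
    exact ⟨t, ht'.2, ht'.1, ht⟩
  have hK : HasEulerChar (P ∩ A ∩ {y | t ≤ l y}) 1 :=
    .compact ((hP.convex.inter hAconv).inter (convex_halfSpace_ge (l : E →ₗ[ℝ] ℝ).isLinear t))
      ((hP.isCompact.inter_right hAclosed).inter_right
        (isClosed_le continuous_const l.continuous)) ⟨x, ⟨hxP, hxA⟩, htx.le⟩
  have hL : HasEulerChar (P ∩ A ∩ {y | l y = t}) 1 := by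
    refine .compact ((hP.convex.inter hAconv).inter
      (convex_hyperplane (l : E →ₗ[ℝ] ℝ).isLinear t))
      ((hP.isCompact.inter_right hAclosed).inter_right
        (isClosed_eq l.continuous continuous_const)) ?_
    have hord : (l '' (P ∩ A)).OrdConnected :=
      ((hP.convex.inter hAconv).is_linear_image (l : E →ₗ[ℝ] ℝ).isLinear).ordConnected
    obtain ⟨y, hy, hyt⟩ := hord.out ⟨_, ⟨hp.1, hpA⟩, rfl⟩ ⟨x, ⟨hxP, hxA⟩, rfl⟩ ⟨htp.le, htx.le⟩
    exact ⟨y, hy, hyt⟩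
  have hU : ∀ G ∈ (nonemptyFaces P).filter (F ≤ ·),
      HasEulerChar (relInt P G ∩ A ∩ {y | t < l y})
        ((-1) ^ (dim F).toNat * (-1) ^ (dim G).toNat) := by
    intro G hG
    rw [Finset.mem_filter, mem_nonemptyFaces hP] at hG
    obtain ⟨⟨hG, -⟩, hFG⟩ := hG
    have hfin := finrank_inf_add_finrank_of_isCompl hN (vectorSpan_mono ℝ hFG)
    have hsgn : (-1 : ℤ) ^ (dim F).toNat * (-1) ^ (dim G).toNat =
        (-1) ^ Module.finrank ℝ (vectorSpan ℝ G ⊓ N : Submodule ℝ E) := by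
      rw [toNat_dim, toNat_dim, ← hfin, pow_add, mul_comm, mul_assoc, ← mul_pow]
      simp
    rw [hsgn]
    refine .relOpen _ (((convex_relInt hP.convex hG).inter hAconv).inter
      (convex_halfSpace_gt (l : E →ₗ[ℝ] ℝ).isLinear t))
      ((isBounded_relInt hP hG).subset fun y hy => hy.1.1) ?_ ?_ ?_
    · obtain ⟨v, hv, h⟩ := exists_add_smul_mem_relInt_of_subset hP hF hG hFG hx hN
      obtain ⟨r, hr0, hr1, hr⟩ := exists_mul_abs_lt (sub_pos.mpr htx) (l v)
      refine ⟨x + r • v, ⟨h r hr0 hr1, ?_⟩, ?_⟩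
      · simpa [hA] using N.smul_mem r hv
      · simp only [Set.mem_ofPred_eq, map_add, map_smul, smul_eq_mul]
        nlinarith [neg_abs_le (l v)]
    · rintro u ⟨⟨hu, huA⟩, -⟩ w ⟨⟨hw, hwA⟩, -⟩
      refine ⟨vsub_mem_vectorSpan ℝ hu.1 hw.1, ?_⟩
      have := N.sub_mem huA hwA
      rwa [sub_sub_sub_cancel_right] at this
    · rintro u ⟨⟨hu, huA⟩, hut⟩ v ⟨hvG, hvN⟩
      obtain ⟨ε, hε, h⟩ := exists_add_smul_mem_relInt hP hG hu hvG
      obtain ⟨r, hr0, hr1, hr⟩ := exists_mul_abs_lt (sub_pos.mpr hut) (ε * l v)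
      refine ⟨r * ε, by positivity, ⟨h r hr0.le hr1, ?_⟩, ?_⟩
      · have := N.add_mem huA (N.smul_mem (r * ε) hvN)
        simp only [hA, Set.mem_ofPred_eq]
        convert this using 1
        abel
      · simp only [Set.mem_ofPred_eq, map_add, map_smul, smul_eq_mul]
        nlinarith [neg_abs_le (ε * l v)]
  -- The cap without its base is partitioned by the relative interiors of the faces above F. Cap and
  -- base are compact and convex, so the total is 1 - 1 = 0.
  have key := sub_eq_sum_of_hasEulerChar ((nonemptyFaces P).filter (F ≤ ·)) hK hL hU fun y => ?_
  · rw [sub_self, ← Finset.mul_sum] at key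
    exact (mul_eq_zero.mp key.symm).resolve_left (pow_ne_zero _ (by norm_num))
  · by_cases hy : y ∈ P ∩ A ∧ t < l y
    · obtain ⟨G, hG, hyG⟩ := exists_mem_relInt hP hy.1.1
      have hGmem : G ∈ nonemptyFaces P := (mem_nonemptyFaces hP).mpr ⟨hG, y, hyG.1⟩
      have hFG : F ⊆ G := by
        by_contra h
        exact (htG G hGmem h y ⟨hyG.1, hy.1.2⟩).not_gt hy.2
      rw [Finset.sum_eq_single_of_mem G (Finset.mem_filter.mpr ⟨hGmem, hFG⟩)]
      · rw [if_pos ⟨hy.1, hy.2.le⟩, if_neg fun h => hy.2.ne' h.2, if_pos ⟨⟨hyG, hy.1.2⟩, hy.2⟩]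
        rfl
      · intro G' hG' hne'
        rw [Finset.mem_filter, mem_nonemptyFaces hP] at hG'
        rw [if_neg fun h => hne' (eq_of_mem_relInt hG'.1.1 hG h.1.1 hyG)]
    · rw [Finset.sum_eq_zero]
      · by_cases hy' : y ∈ P ∩ A ∩ {y | l y = t}
        · rw [if_pos hy', if_pos ⟨hy'.1, hy'.2.ge⟩]
          rfl
        · rw [if_neg hy', if_neg fun h => ?_]
          · rfl
          · rcases (show t ≤ l y from h.2).eq_or_lt with h' | h'
            · exact hy' ⟨h.1, h'.symm⟩
            · exact hy ⟨h.1, h'⟩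
      · intro G hG
        rw [Finset.mem_filter, mem_nonemptyFaces hP] at hG
        rw [if_neg fun h => hy ⟨⟨hG.1.1.subset h.1.1.1, h.1.2⟩, h.2⟩]

end RelInt

end Faces

/-! ### The recursion for the ab-index -/

/-- The ab-polynomial with flag `f`-vector `f`. -/
def abOfFlag (d : ℕ) (f : Finset ℕ → ℤ) : FreeAlgebra ℤ AB :=
  ∑ S ∈ (Finset.range d).powerset,
    (∑ T ∈ S.powerset, (-1) ^ (S.card - T.card) * f T) • abWord d S

theorem abOfFlag_congr {d : ℕ} {f g : Finset ℕ → ℤ} (h : ∀ T ⊆ Finset.range d, f T = g T) :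
    abOfFlag d f = abOfFlag d g := by
  refine Finset.sum_congr rfl fun S hS => ?_
  congr 1
  refine Finset.sum_congr rfl fun T hT => ?_
  rw [h T ((Finset.mem_powerset.mp hT).trans (Finset.mem_powerset.mp hS))]

theorem abOfFlag_sum {ι : Type*} (d : ℕ) (s : Finset ι) (f : ι → Finset ℕ → ℤ) :
    abOfFlag d (fun T => ∑ i ∈ s, f i T) = ∑ i ∈ s, abOfFlag d (f i) := by
  simp only [abOfFlag]
  rw [Finset.sum_comm]
  refine Finset.sum_congr rfl fun S _ => ?_
  rw [← Finset.sum_smul, Finset.sum_comm]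
  simp only [Finset.mul_sum]

theorem abWord_succ_of_notMem {d : ℕ} {S : Finset ℕ} (h : d ∉ S) :
    abWord (d + 1) S = abWord d S * la := by
  simp [abWord, List.range_succ, h]

theorem abWord_succ_insert (d : ℕ) (S : Finset ℕ) :
    abWord (d + 1) (insert d S) = abWord d S * lb := by
  simp only [abWord, List.range_succ, List.map_append, List.prod_append]
  congr 1
  · congr 1
    refine List.map_congr_left fun i hi => ?_
    have : i ≠ d := (List.mem_range.mp hi).ne
    simp [this]
  · simp

theorem abOfFlag_zero (f : Finset ℕ → ℤ) : abOfFlag 0 f = algebraMap ℤ _ (f ∅) := by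
  simp [abOfFlag, abWord]

/-- In the flag h-number of S ∪ {d} the subsets omitting d contribute minus that of S. Hence the
chains avoiding d end in a - b, and those using d end in b. -/
theorem abOfFlag_succ (d : ℕ) (f : Finset ℕ → ℤ) :
    abOfFlag (d + 1) f =
      abOfFlag d f * (la - lb) + abOfFlag d (fun T => f (insert d T)) * lb := by
  have hd : d ∉ Finset.range d := by simp
  have hflag : ∀ S ∈ (Finset.range d).powerset,
      ∑ T ∈ (insert d S).powerset, (-1) ^ ((insert d S).card - T.card) * f T =
      -∑ T ∈ S.powerset, (-1) ^ (S.card - T.card) * f T +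
        ∑ T ∈ S.powerset, (-1) ^ (S.card - T.card) * f (insert d T) := by
    intro S hS
    have hdS : d ∉ S := fun h => hd (Finset.mem_powerset.mp hS h)
    rw [Finset.sum_powerset_insert hdS, ← Finset.sum_neg_distrib]
    congr 1
    · refine Finset.sum_congr rfl fun T hT => ?_
      have hc := Finset.card_le_card (Finset.mem_powerset.mp hT)
      rw [Finset.card_insert_of_notMem hdS, Nat.sub_add_comm hc, pow_succ]
      ring
    · refine Finset.sum_congr rfl fun T hT => ?_
      have hdT : d ∉ T := fun h => hdS (Finset.mem_powerset.mp hT h)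
      rw [Finset.card_insert_of_notMem hdS, Finset.card_insert_of_notMem hdT,
        Nat.add_sub_add_right]
  simp only [abOfFlag]
  rw [Finset.range_add_one, Finset.sum_powerset_insert hd, Finset.sum_mul, Finset.sum_mul,
    ← Finset.sum_add_distrib, ← Finset.sum_add_distrib]
  refine Finset.sum_congr rfl fun S hS => ?_
  rw [hflag S hS, abWord_succ_insert,
    abWord_succ_of_notMem fun h => hd (Finset.mem_powerset.mp hS h)]
  simp only [smul_mul_assoc, mul_sub, add_smul, neg_smul]
  abel

/-- Chains are sorted by their largest dimension s: the letter b stands at position s, and each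
unused later position contributes a - b. -/
theorem abOfFlag_eq (d : ℕ) (f : Finset ℕ → ℤ) :
    abOfFlag d f = f ∅ • (la - lb) ^ d + ∑ s ∈ Finset.range d,
      abOfFlag s (fun T => f (insert s T)) * lb * (la - lb) ^ (d - s - 1) := by
  induction d with
  | zero => rw [abOfFlag_zero]; simp
  | succ d ih =>
    rw [abOfFlag_succ, ih, Finset.sum_range_succ, add_mul, smul_mul_assoc, ← pow_succ,
      Finset.sum_mul, add_assoc]
    congr 2
    · refine Finset.sum_congr rfl fun s hs => ?_
      rw [Finset.mem_range] at hs
      rw [mul_assoc, ← pow_succ, show d - s - 1 + 1 = d + 1 - s - 1 by omega]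
    · simp

section Flags

variable {E : Type*} [NormedAddCommGroup E] [NormedSpace ℝ E] {P G : Set E}

theorem abIndex_eq_abOfFlag (d : ℕ) (P : Set E) :
    abIndex d P = abOfFlag d fun T => (flagF P T : ℤ) := rfl

theorem flagF_empty (P : Set E) : flagF P ∅ = 1 := by
  rw [flagF, Nat.card_eq_one_iff_unique]
  refine ⟨⟨fun F G => Subtype.ext (funext fun i => (Finset.notMem_empty _ i.2).elim)⟩, ⟨⟨fun i => ∅, ?_⟩⟩⟩
  exact ⟨fun i => (Finset.notMem_empty _ i.2).elim, fun i => (Finset.notMem_empty _ i.2).elim⟩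

/-! ### Chains of faces, split at the largest face -/

/-- The type of chains of faces with dimensions in `S`. -/
abbrev Flag (P : Set E) (S : Finset ℕ) : Type _ :=
  {F : S → Set E // StrictMono F ∧ ∀ s, IsExposed ℝ P (F s) ∧ dim (F s) = (s : ℕ)}

theorem finite_flag (hP : IsFiniteHull P) (S : Finset ℕ) : Finite (Flag P S) := by
  have : Finite {F | IsExposed ℝ P F} := hP.finite_faces
  refine Finite.of_injective (β := S → {F | IsExposed ℝ P F})
    (fun F s => ⟨F.1 s, (F.2.2 s).1⟩) fun F F' h => ?_
  ext1
  funext s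
  exact congrArg Subtype.val (congrFun h s)

theorem sigma_flag_ext {p : Set E → Prop} {T : Finset ℕ} {x y : Σ G : {G // p G}, Flag (G : Set E) T}
    (h : x.1.1 = y.1.1) (h' : ∀ t, x.2.1 t = y.2.1 t) : x = y := by
  obtain ⟨⟨G, hG⟩, F⟩ := x
  obtain ⟨⟨G', hG'⟩, F'⟩ := y
  obtain rfl : G = G' := h
  obtain rfl : F = F' := Subtype.ext (funext h')
  rfl

/-- A chain of faces whose largest dimension is `s` consists of a face of dimension `s`
and a chain of faces of the latter. -/
def flagInsertEquiv (hP : IsFiniteHull P) {s : ℕ} {T : Finset ℕ} (hT : T ⊆ Finset.range s) :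
    Flag P (insert s T) ≃
      Σ G : {G : Set E // IsExposed ℝ P G ∧ dim G = s}, Flag (G : Set E) T where
  toFun F := ⟨⟨F.1 ⟨s, Finset.mem_insert_self s T⟩, F.2.2 _⟩,
    ⟨fun t => F.1 ⟨t, Finset.mem_insert_of_mem t.2⟩, fun t u h => F.2.1 h, fun t =>
      ⟨(F.2.2 _).1.mono (F.2.2 _).1.subset (F.2.1 (show (⟨t, _⟩ : ↥(insert s T)) < ⟨s, _⟩ from
        Finset.mem_range.mp (hT t.2))).le, (F.2.2 _).2⟩⟩⟩
  invFun F := ⟨fun i => if h : (i : ℕ) ∈ T then F.2.1 ⟨i, h⟩ else F.1.1, by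
    have hlt : ∀ t : T, F.2.1 t < F.1.1 := fun t => by
      refine lt_of_le_of_ne (F.2.2.2 t).1.subset fun h => ?_
      have h1 := (F.2.2.2 t).2
      rw [h, F.1.2.2] at h1
      have := Finset.mem_range.mp (hT t.2)
      omega
    have hs : s ∉ T := fun h => (Finset.mem_range.mp (hT h)).false
    refine ⟨fun i j hij => ?_, fun i => ?_⟩
    · rcases Finset.mem_insert.mp i.2 with hi | hi <;> rcases Finset.mem_insert.mp j.2 with hj | hj
      · exact absurd (show (i : ℕ) < j from hij) (by omega)
      · have := Finset.mem_range.mp (hT hj)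
        exact absurd (show (i : ℕ) < j from hij) (by omega)
      · simp only [hi, dif_pos, hj, hs, dif_neg, not_false_iff]
        exact hlt _
      · simp only [hi, hj, dif_pos]
        exact F.2.2.1 hij
    · rcases Finset.mem_insert.mp i.2 with hi | hi
      · simp only [hi, hs, dif_neg, not_false_iff]
        exact F.1.2
      · simp only [hi, dif_pos]
        exact ⟨hP.isExposed_trans F.1.2.1 (F.2.2.2 _).1, (F.2.2.2 _).2⟩⟩
  left_inv F := by
    ext1
    funext i
    rcases Finset.mem_insert.mp i.2 with hi | hi
    · have hs : (i : ℕ) ∉ T := fun h => by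
        have := Finset.mem_range.mp (hT h)
        omega
      simp only [hs, dif_neg, not_false_iff]
      exact congrArg F.1 (Subtype.ext hi.symm)
    · simp only [hi, dif_pos]
  right_inv F := by
    have hs : s ∉ T := fun h => (Finset.mem_range.mp (hT h)).false
    refine sigma_flag_ext ?_ fun t => ?_
    · simp only [hs, dif_neg, not_false_iff]
    · simp only [t.2, dif_pos]

open Classical in
theorem flagF_insert (hP : IsFiniteHull P) {s : ℕ} {T : Finset ℕ} (hT : T ⊆ Finset.range s) :
    flagF P (insert s T) = ∑ G ∈ nonemptyFaces P with dim G = s, flagF G T := by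
  have hmem : ∀ G, G ∈ (nonemptyFaces P).filter (dim · = s) ↔ IsExposed ℝ P G ∧ dim G = s := by
    intro G
    rw [Finset.mem_filter, mem_nonemptyFaces hP]
    refine ⟨fun h => ⟨h.1.1, h.2⟩, fun h => ⟨⟨h.1, ?_⟩, h.2⟩⟩
    rw [Set.nonempty_iff_ne_empty]
    rintro rfl
    have := h.2
    simp only [dim, if_true] at this
    omega
  have : Finite {G : Set E // IsExposed ℝ P G ∧ dim G = s} :=
    hP.finite_faces.subset fun G hG => hG.1
  have := Fintype.ofFinite {G : Set E // IsExposed ℝ P G ∧ dim G = s}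
  have (G : {G : Set E // IsExposed ℝ P G ∧ dim G = s}) : Finite (Flag (G : Set E) T) :=
    finite_flag (hP.face G.2.1) T
  rw [flagF, Nat.card_congr (flagInsertEquiv hP hT), Nat.card_sigma]
  exact (Finset.sum_subtype _ hmem fun G => flagF G T).symm

open Classical in
theorem abIndex_eq (hP : IsFiniteHull P) (d : ℕ) :
    abIndex d P = (la - lb) ^ d + ∑ s ∈ Finset.range d,
      ∑ G ∈ nonemptyFaces P with dim G = s, abIndex s G * lb * (la - lb) ^ (d - s - 1) := by
  rw [abIndex_eq_abOfFlag, abOfFlag_eq, flagF_empty, Nat.cast_one, one_smul]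
  congr 1
  refine Finset.sum_congr rfl fun s _ => ?_
  rw [abOfFlag_congr (g := fun T => ∑ G ∈ nonemptyFaces P with dim G = s, (flagF G T : ℤ))
    fun T hT => by rw [flagF_insert hP hT, Nat.cast_sum], abOfFlag_sum, Finset.sum_mul,
    Finset.sum_mul]
  rfl

open Classical in
/-- The recursion for the ab-index, as a sum over proper faces. -/
theorem abIndex_toNat_dim_eq [FiniteDimensional ℝ E] (hP : IsFiniteHull P) (hne : P.Nonempty) :
    abIndex (dim P).toNat P = (la - lb) ^ (dim P).toNat + ∑ G ∈ nonemptyFaces P with G < P,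
      abIndex (dim G).toNat G * lb * (la - lb) ^ ((dim P).toNat - (dim G).toNat - 1) := by
  rw [abIndex_eq hP]
  congr 1
  have hlt : ∀ G ∈ (nonemptyFaces P).filter (· < P), (dim G).toNat < (dim P).toNat := by
    intro G hG
    rw [Finset.mem_filter, mem_nonemptyFaces hP] at hG
    have := dim_lt_of_mem_properFaces ⟨hG.1.1, hG.2.ne⟩
    rw [dim_of_nonempty hne, dim_of_nonempty hG.1.2] at this
    exact_mod_cast this
  -- The proper faces are grouped by dimension, to match the outer sum of `abIndex_eq`.
  rw [← Finset.sum_fiberwise_of_maps_to (t := Finset.range (dim P).toNat)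
    (g := fun G => (dim G).toNat) fun G hG => Finset.mem_range.mpr (hlt G hG)]
  refine Finset.sum_congr rfl fun s hs => ?_
  rw [Finset.mem_range] at hs
  rw [Finset.filter_filter]
  refine Finset.sum_congr ?_ fun G hG => ?_
  · refine Finset.filter_congr fun G hG => ?_
    rw [mem_nonemptyFaces hP] at hG
    have h1 := dim_of_nonempty hG.2
    constructor
    · intro h
      refine ⟨lt_of_le_of_ne hG.1.subset ?_, by omega⟩
      rintro rfl
      omega
    · rintro ⟨-, h⟩
      omega
  · rw [(Finset.mem_filter.mp hG).2.2]

theorem mem_nonemptyFaces_face (hP : IsFiniteHull P) (hG : IsExposed ℝ P G) {F : Set E} :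
    F ∈ nonemptyFaces G ↔ F ∈ nonemptyFaces P ∧ F ⊆ G := by
  rw [mem_nonemptyFaces hP, mem_nonemptyFaces (hP.face hG)]
  exact ⟨fun h => ⟨⟨hP.isExposed_trans hG h.1, h.2⟩, h.1.subset⟩,
    fun h => ⟨h.1.1.mono hG.subset h.2, h.1.2⟩⟩

theorem toNat_dim_lt [FiniteDimensional ℝ E] (hP : IsFiniteHull P) {F : Set E}
    (hF : F ∈ nonemptyFaces P) (hG : G ∈ nonemptyFaces P) (h : F < G) :
    (dim F).toNat < (dim G).toNat := by
  rw [mem_nonemptyFaces hP] at hF hG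
  have := dim_lt_of_mem_properFaces ⟨hF.1.mono hG.1.subset h.le, h.ne⟩
  rw [dim_of_nonempty hF.2, dim_of_nonempty hG.2] at this
  exact_mod_cast this

/-! ### Existence of the cd-index -/

theorem sub_sq_mem_range : (la - lb) ^ 2 ∈ cdToAb.range := by
  refine ⟨lc ^ 2 - 2 * ld, ?_⟩
  have : cdToAb (lc ^ 2 - 2 * ld) = (la - lb) ^ 2 := by
    rw [map_sub, map_mul, map_pow, cdToAb_lc, cdToAb_ld, map_ofNat]
    noncomm_ring
  exact this

theorem sub_pow_mem_range {k : ℕ} (hk : Even k) : (la - lb) ^ k ∈ cdToAb.range := by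
  obtain ⟨m, rfl⟩ := hk
  rw [← two_mul, pow_mul]
  exact pow_mem sub_sq_mem_range m

theorem add_mem_range : la + lb ∈ cdToAb.range := ⟨lc, cdToAb_lc⟩

/-- Induction on dimension: `two_mul_eq_of_eulerian` with e = a - b, so that e + b = a, writes 2Ψ(P)
through the Ψ(G) of proper faces and cd-polynomials. -/
theorem abIndex_mem_range [FiniteDimensional ℝ E] (hP : IsFiniteHull P) (hne : P.Nonempty) :
    abIndex (dim P).toNat P ∈ cdToAb.range := by
  classical
  induction hd : (dim P).toNat using Nat.strong_induction_on generalizing P with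
  | _ d ih =>
    subst hd
    have hPmem : P ∈ nonemptyFaces P := (mem_nonemptyFaces hP).mpr ⟨IsExposed.refl P, hne⟩
    have key := two_mul_eq_of_eulerian (nonemptyFaces P) (fun G => (dim G).toNat)
      (fun F hF G hG h => toNat_dim_lt hP hF hG h) hPmem
      (fun G hG => ((mem_nonemptyFaces hP).mp hG).1.subset)
      (fun G => abIndex (dim G).toNat G) (la - lb) lb
      (fun G hG => by
        rw [mem_nonemptyFaces hP] at hG
        rw [abIndex_toNat_dim_eq (hP.face hG.1) hG.2]
        congr 1
        refine Finset.sum_congr ?_ fun _ _ => rfl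
        ext F
        simp only [Finset.mem_filter, mem_nonemptyFaces_face hP hG.1]
        exact ⟨fun h => ⟨h.1.1, h.2⟩, fun h => ⟨⟨h.1, h.2.le⟩, h.2⟩⟩)
      (sum_nonemptyFaces hP hne)
      (fun F hF h => by
        rw [mem_nonemptyFaces hP] at hF
        exact sum_nonemptyFaces_superset hP hF.1 hF.2 h.ne)
    apply mem_range_cdToAb_of_two_mul
    rw [key]
    refine add_mem ?_ (sum_mem fun G hG => ?_)
    · rcases Nat.even_or_odd (dim P).toNat with h | h
      · rw [h.neg_one_pow]
        exact mul_mem (add_mem (one_mem _) (one_mem _)) (sub_pow_mem_range h)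
      · rw [h.neg_one_pow, add_neg_cancel, zero_mul]
        exact zero_mem _
    · rw [Finset.mem_filter] at hG
      have hlt := toNat_dim_lt hP hG.1 hPmem hG.2
      have hG' := (mem_nonemptyFaces hP).mp hG.1
      rw [mul_assoc]
      refine mul_mem (ih _ hlt (hP.face hG'.1) hG'.2 rfl) ?_
      obtain ⟨k, hk⟩ : ∃ k, (dim P).toNat - (dim G).toNat = k + 1 :=
        ⟨(dim P).toNat - (dim G).toNat - 1, by omega⟩
      rw [hk, Nat.add_sub_cancel]
      -- With e = a - b, the factor after Ψ(G) is c e^k for even k and -e^(k+1) for odd k. Either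
      -- way e occurs to an even power.
      rcases Nat.even_or_odd k with h | h
      · rw [h.add_one.neg_one_pow, show lb - -1 * (la - lb + lb) = la + lb by noncomm_ring]
        exact mul_mem add_mem_range (sub_pow_mem_range h)
      · rw [h.add_one.neg_one_pow, show lb - 1 * (la - lb + lb) = -(la - lb) by noncomm_ring,
          neg_mul, ← pow_succ']
        exact neg_mem (sub_pow_mem_range h.add_one)

/-! ### The toric `h`-polynomial -/

theorem dim_empty : dim (∅ : Set E) = -1 := by simp [dim]

open Classical in
theorem toricHPoly_eq [FiniteDimensional ℝ E] (hP : IsFiniteHull P) (hne : P.Nonempty) :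
    toricHPoly P = (X - 1) ^ (dim P).toNat + ∑ G ∈ nonemptyFaces P with G < P,
      gPoly (dim G).toNat (toricHPoly G) * (X - 1) ^ ((dim P).toNat - (dim G).toNat - 1) := by
  have hset : properFaces P =
      ((insert ∅ ((nonemptyFaces P).filter (· < P)) : Finset (Set E)) : Set (Set E)) := by
    ext G
    simp only [properFaces, Set.mem_ofPred_eq, Finset.coe_insert, Set.mem_insert_iff,
      Finset.mem_coe, Finset.mem_filter, mem_nonemptyFaces hP]
    constructor
    · rintro ⟨hG, hGP⟩
      rcases G.eq_empty_or_nonempty with h | h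
      · exact Or.inl h
      · exact Or.inr ⟨⟨hG, h⟩, lt_of_le_of_ne hG.subset hGP⟩
    · rintro (rfl | h)
      · exact ⟨isExposed_empty, hne.ne_empty.symm⟩
      · exact ⟨h.1.1, h.2.ne⟩
  have hd := dim_of_nonempty hne
  rw [toricHPoly, if_neg hne.ne_empty, finsum_set_coe_eq_finsum_mem (properFaces P)
    (f := fun G => (if G = ∅ then 1 else gPoly (dim G).toNat (toricHPoly G)) *
      (X - 1) ^ (dim P - 1 - dim G).toNat), hset, finsum_mem_coe_finset,
    Finset.sum_insert (by simp [mem_nonemptyFaces hP])]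
  congr 1
  -- The empty face has dimension -1, so its exponent is dim P.
  · rw [if_pos rfl, one_mul, dim_empty]
    congr 2
    omega
  · refine Finset.sum_congr rfl fun G hG => ?_
    rw [Finset.mem_filter, mem_nonemptyFaces hP] at hG
    have := dim_of_nonempty hG.1.2
    rw [if_neg hG.1.2.ne_empty]
    congr 2
    omega

/-- `abIndex_toNat_dim_eq` and `toricHPoly_eq` agree term by term under the action. By induction
Ψ(G) yields h(∂G), b turns it into g(∂G), and each a - b multiplies by x - 1. -/
theorem toricOfAb_abIndex [FiniteDimensional ℝ E] (hP : IsFiniteHull P) (hne : P.Nonempty) :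
    toricOfAb (abIndex (dim P).toNat P) = Finsupp.single (dim P).toNat (toricHPoly P) := by
  classical
  induction hd : (dim P).toNat using Nat.strong_induction_on generalizing P with
  | _ d ih =>
    subst hd
    have hPmem : P ∈ nonemptyFaces P := (mem_nonemptyFaces hP).mpr ⟨IsExposed.refl P, hne⟩
    rw [abIndex_toNat_dim_eq hP hne, toricHPoly_eq hP hne, toricOfAb_add, toricOfAb_sum,
      Finsupp.single_add, ← Finsupp.singleAddHom_apply _ (∑ _ ∈ _, _), map_sum]
    congr 1
    · have := toricOfAb_mul_sub_pow 1 (n := 0) (p := 1)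
        (by simpa using toricOfAb_algebraMap 1) (dim P).toNat
      simpa using this
    · refine Finset.sum_congr rfl fun G hG => ?_
      rw [Finset.mem_filter] at hG
      have hlt := toNat_dim_lt hP hG.1 hPmem hG.2
      have hG' := (mem_nonemptyFaces hP).mp hG.1
      have h := ih _ hlt (hP.face hG'.1) hG'.2 rfl
      have := toricOfAb_mul_sub_pow (abIndex (dim G).toNat G * lb)
        (by rw [toricOfAb_mul_lb, h, bOp_single]) ((dim P).toNat - (dim G).toNat - 1)
      rw [this, Finsupp.singleAddHom_apply]
      congr 1
      omega

end Flags

end CDToric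

end

/-- A convex `d`-polytope `P` has a unique cd-index `Φ`, and `h(∂P) = (1) Φ`. -/
theorem theorem4p2 {E : Type*} [NormedAddCommGroup E] [NormedSpace ℝ E] [FiniteDimensional ℝ E]
    (d : ℕ) (P : Set E) (hP : CDToric.IsPolytope d P) :
    (∃! Φ : FreeAlgebra ℤ CDToric.CD, CDToric.IsCDIndex d P Φ) ∧
    ∀ Φ : FreeAlgebra ℤ CDToric.CD, CDToric.IsCDIndex d P Φ →
      CDToric.vec d (CDToric.toricH d P) = CDToric.act (CDToric.vec 0 ![1]) Φ := by
  obtain ⟨hull, hdim⟩ := hP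
  have hne : P.Nonempty := by
    rw [Set.nonempty_iff_ne_empty]
    rintro rfl
    rw [CDToric.dim_empty] at hdim
    omega
  obtain rfl : d = (CDToric.dim P).toNat := by omega
  refine ⟨?_, fun Φ hΦ => ?_⟩
  · obtain ⟨Φ, hΦ⟩ := CDToric.abIndex_mem_range hull hne
    exact ⟨Φ, hΦ, fun Θ hΘ => CDToric.cdToAb_injective (Eq.trans hΘ (Eq.symm hΦ))⟩
  · have h : CDToric.vectorsToPoly (CDToric.act (CDToric.vec 0 ![1]) Φ) =
        Finsupp.single (CDToric.dim P).toNat (CDToric.toricHPoly P) := by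
      rw [(CDToric.vectorsToPoly_act Φ).2, show CDToric.cdToAb Φ = _ from hΦ,
        CDToric.toricOfAb_abIndex hull hne]
    -- `vectorsToPoly` has a left inverse, so the identity of polynomials gives that of vectors;
    -- `toricH` is by definition `ofPoly` of the toric polynomial.
    rw [← CDToric.polyToVectors_vectorsToPoly (CDToric.act _ Φ), h, CDToric.polyToVectors_single]
    rfl
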